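/- Let $m,N\ge 1$ be integers with $N+1\ge m$, let $a<b$ be real, $h=\frac{b-a}{N}$, $x_\beta=h\beta+a$ ($\beta=0,\dots,N$), and let $\omega\neq 0$ be real with $\omega h\in\mathbb Z$. Let $L_2^{(m)}[a,b]$ be the space of functions $\varphi:[a,b]\to\mathbb C$ whose $(m-1)$-th derivative exists and is absolutely continuous on $[a,b]$ and whose $m$-th derivative is square integrable, with (semi)norm $\|\varphi\|=\left(\int_a^b|\varphi^{(m)}(x)|^2\,dx\right)^{1/2}$. For $C=(C_0,\dots,C_N)\in\mathbb C^{N+1}$ put $$(\ell_C,\varphi)=\int_a^b e^{2\pi i\omega x}\varphi(x)\,dx-\sum_{\beta=0}^N C_\beta\varphi(x_\beta),\qquad \|\ell_C\|=\sup\{|(\ell_C,\varphi)|:\varphi\in L_2^{(m)}[a,b],\ \|\varphi\|\le 1\}\in[0,\infty].$$ Call $C$ optimal (in the sense of Sard) if $(\ell_C,x^\alpha)=0$ for $\alpha=0,\dots,m-1$ and $\|\ell_C\|=\inf_{C'\in\mathbb C^{N+1}}\|\ell_{C'}\|$. Let $E_{2m-2}$ be the Euler–Frobenius polynomial of degree $2m-2$,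 where $E_k(x)=\frac{(1-x)^{k+2}}{x}\left(x\frac{d}{dx}\right)^k\frac{x}{(1-x)^2}$, and let $\Delta^t0^j=\sum_{l=1}^t(-1)^{t-l}\binom{t}{l}l^j$. Then $E_{2m-2}$ has exactly $m-1$ distinct complex roots $q_1,\dots,q_{m-1}$ of modulus less than $1$. For any numbering of these roots the following system of $2m-2$ linear equations in $a_k,b_k\in\mathbb C$ ($k=1,\dots,m-1$) has a unique solution: for $j=1,\dots,m-1$, $$\sum_{k=1}^{m-1}a_k\sum_{t=1}^{j}\frac{q_k\Delta^t0^j}{(q_k-1)^{t+1}}+\sum_{k=1}^{m-1}b_k\sum_{t=1}^j\frac{q_k^{N+t}\Delta^t0^{j}}{(1-q_k)^{t+1}}=\frac{j!\,e^{2\pi i\omega a}}{(2\pi i\omega h)^{j+1}},$$ and, for $j=1,\dots,m-1$, $$\sum_{k=1}^{m-1}a_k\Bigg[\sum_{t=1}^j\frac{q_k^t\Delta^t0^j}{(1-q_k)^{t+1}}-\sum_{\alpha=1}^{j}\Big(\frac{h}{b-a}\Big)^{\alpha-j}\binom{j}{\alpha}\sum_{t=1}^{\alpha}\frac{q_k^{N+t}\Delta^t0^{\alpha}}{(1-q_k)^{t+1}}\Bigg]$$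 $$+\sum_{k=1}^{m-1}b_k\Bigg[\sum_{t=1}^j\frac{q_k^{N+1}\Delta^t0^j}{(q_k-1)^{t+1}}-\sum_{\alpha=1}^{j}\Big(\frac{h}{b-a}\Big)^{\alpha-j}\binom{j}{\alpha}\sum_{t=1}^{\alpha}\frac{q_k\Delta^t0^{\alpha}}{(q_k-1)^{t+1}}\Bigg]$$ $$=\frac{(-1)^{j+1}j!\,e^{2\pi i\omega a}}{(2\pi i\omega h)^{j+1}}+\sum_{\alpha=1}^{j}\Big(\frac{h}{b-a}\Big)^{\alpha-j}\frac{(-1)^{\alpha}j!\,e^{2\pi i\omega b}}{(j-\alpha)!\,(2\pi i\omega h)^{\alpha+1}}.$$ With this solution there is exactly one optimal $C$, namely $$C_0=h\left(-\frac{e^{2\pi i\omega a}}{2\pi i\omega h}+\sum_{k=1}^{m-1}\Big(a_k\frac{q_k}{q_k-1}+b_k\frac{q_k^N}{1-q_k}\Big)\right),$$ $$C_\beta=h\sum_{k=1}^{m-1}\left(a_kq_k^\beta+b_kq_k^{N-\beta}\right),\qquad \beta=1,\dots,N-1,$$ $$C_N=h\left(\frac{e^{2\pi i\omega b}}{2\pi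 i\omega h}+\sum_{k=1}^{m-1}\Big(a_k\frac{q_k^N}{1-q_k}+b_k\frac{q_k}{q_k-1}\Big)\right).$$ -/

import Mathlib

open MeasureTheory
open scoped ENNReal

noncomputable section

namespace OptQuad

/-! ### The Sobolev space of order `m` on `[a,b]` -/

/-- The `k`-th derivative of `φ` on the closed interval `[a,b]` (one-sided at the endpoints). -/
def derivOn (a b : ℝ) (k : ℕ) (φ : ℝ → ℂ) : ℝ → ℂ :=
  iteratedDerivWithin k φ (Set.Icc a b)

/-- Membership in `L₂^{(m)}[a,b]`, `m ≥ 1`: the `(m-1)`-th derivative exists and is absolutely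
continuous on `[a,b]`, and the `m`-th derivative (which then exists almost everywhere) is square
integrable on `[a,b]`. Only the values of `φ` on `[a,b]` matter. -/
structure MemL2m (m : ℕ) (a b : ℝ) (φ : ℝ → ℂ) : Prop where
  contDiffOn : ContDiffOn ℝ ((m - 1 : ℕ) : WithTop ℕ∞) φ (Set.Icc a b)
  absolutelyContinuous : AbsolutelyContinuousOnInterval (derivOn a b (m - 1) φ) a b
  square_integrable : MemLp (derivOn a b m φ) 2 (volume.restrict (Set.Icc a b))

/-- The norm `(∫_a^b |φ^{(m)}(x)|² dx)^{1/2}` of `L₂^{(m)}[a,b]`; it vanishes on polynomials of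
degree `< m`. -/
def l2mNorm (m : ℕ) (a b : ℝ) (φ : ℝ → ℂ) : ℝ :=
  Real.sqrt (∫ x in a..b, ‖derivOn a b m φ x‖ ^ 2)

/-! ### Quadrature formulas for Fourier integrals and their optimality -/

/-- The step `h = (b-a)/N`. -/
def step (a b : ℝ) (N : ℕ) : ℝ := (b - a) / N

/-- The nodes `x_β = hβ + a`. -/
def node (a b : ℝ) (N : ℕ) (β : ℕ) : ℝ := step a b N * β + a

/-- The error `(ℓ, φ) = ∫_a^b e^{2πiωx} φ(x) dx - ∑_{β=0}^N C_β φ(x_β)`. -/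
def quadError (ω a b : ℝ) (N : ℕ) (C : Fin (N + 1) → ℂ) (φ : ℝ → ℂ) : ℂ :=
  (∫ x in a..b, Complex.exp (2 * Real.pi * Complex.I * ω * x) * φ x)
    - ∑ β : Fin (N + 1), C β * φ (node a b N β)

/-- The norm of the error functional `ℓ` in the dual of `L₂^{(m)}[a,b]`, the supremum of `|(ℓ, φ)|`
over the unit ball; the value is `∞` if `ℓ` is not a bounded functional on `L₂^{(m)}[a,b]`. -/
def errorNorm (m : ℕ) (ω a b : ℝ) (N : ℕ) (C : Fin (N + 1) → ℂ) : ℝ≥0∞ :=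
  ⨆ (φ : ℝ → ℂ) (_ : MemL2m m a b φ) (_ : l2mNorm m a b φ ≤ 1), ‖quadError ω a b N C φ‖ₑ

/-- The coefficients `C` are optimal in the sense of Sard: the formula is exact for the powers
`x^α`, `α = 0, …, m-1` (so that `ℓ` is a functional on `L₂^{(m)}[a,b]`), and the norm of the error
functional is the smallest possible among all choices of the coefficients. -/
def IsOptimal (m : ℕ) (ω a b : ℝ) (N : ℕ) (C : Fin (N + 1) → ℂ) : Prop :=
  (∀ α < m, quadError ω a b N C (fun x => (x : ℂ) ^ α) = 0) ∧
    errorNorm m ω a b N C = ⨅ C' : Fin (N + 1) → ℂ, errorNorm m ω a b N C'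

/-! ### Euler-Frobenius polynomials -/

/-- The Euler-Frobenius polynomial `E_k`, given by the recursion that expresses
`E_k(x) = ((1-x)^{k+2}/x) (x d/dx)^k (x/(1-x)^2)`; see `eval_eulerFrobenius`. -/
def eulerFrobenius : ℕ → Polynomial ℂ
  | 0 => 1
  | k + 1 => (1 + (k + 1 : Polynomial ℂ) * Polynomial.X) * eulerFrobenius k
      + Polynomial.X * (1 - Polynomial.X) * Polynomial.derivative (eulerFrobenius k)

/-- The operator `x d/dx`. -/
def xDeriv (f : ℂ → ℂ) : ℂ → ℂ := fun x => x * deriv f x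

theorem iterate_xDeriv (k : ℕ) : ∀ x : ℂ, x ≠ 1 →
    (xDeriv^[k] (fun y => y / (1 - y) ^ 2)) x
      = x * (eulerFrobenius k).eval x / (1 - x) ^ (k + 2) := by
  induction k with
  | zero => intro x _; simp [eulerFrobenius]
  | succ k ih =>
    intro x hx
    have h1 : (1 - x) ≠ 0 := sub_ne_zero.mpr (Ne.symm hx)
    rw [Function.iterate_succ_apply']
    have hev : (xDeriv^[k] (fun y => y / (1 - y) ^ 2)) =ᶠ[nhds x]
        fun y => y * (eulerFrobenius k).eval y / (1 - y) ^ (k + 2) := by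
      filter_upwards [isOpen_ne.mem_nhds hx] with y hy using ih y hy
    have hd : HasDerivAt (fun y : ℂ => y * (eulerFrobenius k).eval y / (1 - y) ^ (k + 2))
        (((1 * (eulerFrobenius k).eval x + x * (eulerFrobenius k).derivative.eval x)
          * (1 - x) ^ (k + 2)
          - x * (eulerFrobenius k).eval x * (((k + 2 : ℕ) : ℂ) * (1 - x) ^ (k + 1) * (-1)))
          / ((1 - x) ^ (k + 2)) ^ 2) x := by
      have hp : HasDerivAt (fun y : ℂ => (1 - y) ^ (k + 2))
          (((k + 2 : ℕ) : ℂ) * (1 - x) ^ (k + 1) * (-1)) x := by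
        exact ((hasDerivAt_id x).const_sub 1).pow (k + 2)
      exact ((hasDerivAt_id x).mul ((eulerFrobenius k).hasDerivAt x)).div hp (pow_ne_zero _ h1)
    simp only [xDeriv]
    rw [hev.deriv_eq, hd.deriv]
    simp only [eulerFrobenius, Polynomial.eval_add, Polynomial.eval_mul, Polynomial.eval_sub,
      Polynomial.eval_one, Polynomial.eval_X, Polynomial.eval_natCast]
    field_simp
    push_cast
    ring

/-- The classical formula for the Euler-Frobenius polynomials. -/
theorem eval_eulerFrobenius (k : ℕ) (x : ℂ) (h0 : x ≠ 0) (h1 : x ≠ 1) :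
    (eulerFrobenius k).eval x
      = (1 - x) ^ (k + 2) / x * (xDeriv^[k] (fun y => y / (1 - y) ^ 2)) x := by
  have h : (1 - x) ≠ 0 := sub_ne_zero.mpr (Ne.symm h1)
  rw [iterate_xDeriv k x h1]
  field_simp

/-- `q_1, …, q_{m-1}` is a list without repetition of all the (complex) roots `z` of the
Euler-Frobenius polynomial `E_{2m-2}` with `|z| < 1`. -/
def IsRootList (m : ℕ) (q : Fin (m - 1) → ℂ) : Prop :=
  Function.Injective q ∧
    ∀ z : ℂ, ((eulerFrobenius (2 * m - 2)).eval z = 0 ∧ ‖z‖ < 1) ↔ ∃ k, q k = z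

/-! ### The linear system and the coefficients -/

/-- `Δ^t 0^j = ∑_{l=1}^t (-1)^{t-l} binom(t,l) l^j`. -/
def diffZero (t j : ℕ) : ℂ :=
  ∑ l ∈ Finset.Icc 1 t, (-1 : ℂ) ^ (t - l) * (t.choose l : ℂ) * (l : ℂ) ^ j

/-- The number `e^{2πiωx}`. -/
def expo (ω x : ℝ) : ℂ := Complex.exp (2 * Real.pi * Complex.I * ω * x)

/-- The number `2πiωh`. -/
def freq (ω h : ℝ) : ℂ := 2 * Real.pi * Complex.I * ω * h

/-- The system of `2m-2` linear equations for the unknowns `a_k = A k` and `b_k = B k`. -/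
def IsSolution (m : ℕ) (ω a b : ℝ) (N : ℕ) (q A B : Fin (m - 1) → ℂ) : Prop :=
  let h := step a b N
  (∀ j ∈ Finset.Icc 1 (m - 1),
    ∑ k, A k * (∑ t ∈ Finset.Icc 1 j, q k * diffZero t j / (q k - 1) ^ (t + 1))
      + ∑ k, B k * (∑ t ∈ Finset.Icc 1 j, q k ^ (N + t) * diffZero t j / (1 - q k) ^ (t + 1))
      = (j.factorial : ℂ) * expo ω a / freq ω h ^ (j + 1)) ∧
  (∀ j ∈ Finset.Icc 1 (m - 1),
    ∑ k, A k * ((∑ t ∈ Finset.Icc 1 j, q k ^ t * diffZero t j / (1 - q k) ^ (t + 1))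
        - ∑ α ∈ Finset.Icc 1 j, ((h / (b - a) : ℝ) : ℂ) ^ ((α : ℤ) - (j : ℤ)) * (j.choose α : ℂ)
          * ∑ t ∈ Finset.Icc 1 α, q k ^ (N + t) * diffZero t α / (1 - q k) ^ (t + 1))
      + ∑ k, B k * ((∑ t ∈ Finset.Icc 1 j, q k ^ (N + 1) * diffZero t j / (q k - 1) ^ (t + 1))
        - ∑ α ∈ Finset.Icc 1 j, ((h / (b - a) : ℝ) : ℂ) ^ ((α : ℤ) - (j : ℤ)) * (j.choose α : ℂ)
          * ∑ t ∈ Finset.Icc 1 α, q k * diffZero t α / (q k - 1) ^ (t + 1))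
      = (-1 : ℂ) ^ (j + 1) * (j.factorial : ℂ) * expo ω a / freq ω h ^ (j + 1)
        + ∑ α ∈ Finset.Icc 1 j, ((h / (b - a) : ℝ) : ℂ) ^ ((α : ℤ) - (j : ℤ))
          * ((-1 : ℂ) ^ α * (j.factorial : ℂ) * expo ω b
            / (((j - α).factorial : ℂ) * freq ω h ^ (α + 1))))

end OptQuad

end

noncomputable section

namespace OptQuad

/-! Optimality is certified by a potential. Suppose F vanishes at every node and the error
functional of C is φ ↦ (-1)^m ∫ F^{(m)} φ^{(m)}. Cauchy-Schwarz bounds its norm by ρ, the L² norm of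
F^{(m)}. Conversely, conj F does not see the coefficients, so every error functional takes the value
(-1)^m ρ² at conj F and has norm at least ρ. If C' also attains ρ, varying conj F in a direction G
shows that the functionals of C' and C agree on smooth functions, and Lagrange polynomials give C' =
C. This is `isOptimal_iff_of_representation`.

The potential is explicit. With c = 2πiω it is e^{cx}/c^{2m} minus a spline of degree 2m-1 whose
jumps at the interior nodes are the coefficients C_β. Because ωh is an integer, e^{cx} has the same
value at all nodes, so up to a constant the spline must vanish at the nodes. Exponential Euler
splines, those with S(x+1) = r S(x), take the values r^β G_n(s) at the integers, where s = r/(r-1)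
and G_n is `momentPoly`. For n = 2m-1 they vanish there when r is a root of E_{2m-2}
(`momentPoly_eval_mul_pow`, `eulerSpline_node`). These roots come in pairs q_k, 1/q_k, with
amplitudes a_k and b_k q_k^N.

Repeated integration by parts turns ∫ F^{(m)} φ^{(m)} into the quadrature error with the stated
coefficients, provided the derivatives of F of orders m, …, 2m-2 vanish at a and b
(`eulerSpline_representation`). These 2m-2 conditions are equivalent to the linear system
(`isSolution_iff`).

The system is square, so it suffices to treat the homogeneous case. There F has no exponential part.
Testing the representation against conj F gives ∫ |F^{(m)}|² = 0, so F is a polynomial of degree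
below m with N+1 ≥ m zeros, hence zero; a Vandermonde argument then removes the amplitudes
(`eq_zero_of_moment_eq_zero`).

For the root count, Rolle's theorem makes all roots of G_{n+1} real and simple. Those of E_{2m-2}
are then real, distinct and closed under z ↦ 1/z, and by parity none has modulus 1. -/

open Polynomial in
/-- The polynomials `G_0 = X`, `G_{n+1} = X (X - 1) G_n'`; in the variable `s = r / (r - 1)` they
are the scaled Taylor coefficients of `r / (r - e^z)`. -/
def momentPoly (R : Type*) [CommRing R] : ℕ → R[X]
  | 0 => X
  | n + 1 => X * (X - 1) * derivative (momentPoly R n)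

/-! ### Algebra of the polynomials G_n -/

section algebra

open Polynomial

variable {R : Type*} [CommRing R]

theorem momentPoly_zero : momentPoly R 0 = X := rfl

theorem momentPoly_succ (n : ℕ) :
    momentPoly R (n + 1) = X * (X - 1) * derivative (momentPoly R n) := rfl

theorem momentPoly_map {S : Type*} [CommRing S] (f : R →+* S) (n : ℕ) :
    (momentPoly R n).map f = momentPoly S n := by
  induction n with
  | zero => simp [momentPoly_zero]
  | succ n ih => simp [momentPoly_succ, ← ih, derivative_map]

theorem momentPoly_natDegree_le (n : ℕ) : (momentPoly R n).natDegree ≤ n + 1 := by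
  induction n with
  | zero => exact natDegree_X_le
  | succ n ih =>
    have h1 : (X * (X - 1) : R[X]).natDegree ≤ 2 := by
      refine natDegree_mul_le.trans ?_
      have := natDegree_sub_le (X : R[X]) 1
      have h2 := natDegree_X_le (R := R)
      simp only [natDegree_one] at this
      omega
    have h2 := natDegree_derivative_le (momentPoly R n)
    rw [momentPoly_succ]
    refine natDegree_mul_le.trans ?_
    omega

theorem momentPoly_coeff (n : ℕ) : (momentPoly R n).coeff (n + 1) = (n.factorial : R) := by
  induction n with
  | zero => simp [momentPoly_zero]
  | succ n ih =>
    have h2 : (derivative (momentPoly R n)).coeff (n + 1) = 0 := by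
      apply coeff_eq_zero_of_natDegree_lt
      have h2 := natDegree_derivative_le (momentPoly R n)
      have := momentPoly_natDegree_le (R := R) n
      omega
    rw [momentPoly_succ, mul_assoc, coeff_X_mul, sub_mul, one_mul, coeff_sub, coeff_X_mul, h2,
      coeff_derivative, ih, Nat.factorial_succ]
    push_cast
    ring

theorem momentPoly_ne_zero [CharZero R] (n : ℕ) : momentPoly R n ≠ 0 := by
  intro h
  have := momentPoly_coeff (R := R) n
  rw [h, coeff_zero] at this
  exact (Nat.factorial_ne_zero n) (by exact_mod_cast this.symm)

/-- In terms of s = r/(r-1), the map s ↦ 1-s is r ↦ 1/r; this is the source of the reciprocity of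
the Euler-Frobenius polynomials. The index starts at 1 because G_0 = X has no such symmetry. -/
theorem momentPoly_comp_one_sub (n : ℕ) :
    (momentPoly R (n + 1)).comp (1 - X) = (-1) ^ n * momentPoly R (n + 1) := by
  induction n with
  | zero => simp [momentPoly_succ, momentPoly_zero]; ring
  | succ n ih =>
    have hd : (derivative (momentPoly R (n + 1))).comp (1 - X)
        = - ((-1) ^ n * derivative (momentPoly R (n + 1))) := by
      have h := congrArg derivative ih
      rw [derivative_comp] at h
      have h3 : derivative ((-1) ^ n * momentPoly R (n + 1))
          = (-1) ^ n * derivative (momentPoly R (n + 1)) := by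
        rw [show ((-1) ^ n : R[X]) = C ((-1) ^ n) by simp, derivative_C_mul]
      rw [h3] at h
      rw [← h]
      simp
    rw [momentPoly_succ (n + 1), mul_comp, hd]
    simp
    ring

theorem momentPoly_eval_one_sub (n : ℕ) (s : R) :
    (momentPoly R (n + 1)).eval (1 - s) = (-1) ^ n * (momentPoly R (n + 1)).eval s := by
  have h := congrArg (eval s) (momentPoly_comp_one_sub (R := R) n)
  simpa [eval_comp] using h

/-- For S(z) = r/(r-e^z) one has e^z S = r S - r, and this is the Leibniz rule for its derivatives
of order n+1 at z = 0. The algebraic proof applies X(X-1) d/dX and Pascal's rule. -/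
theorem momentPoly_recurrence (n : ℕ) :
    momentPoly R (n + 1)
      = (X - 1) * ∑ i ∈ Finset.range (n + 1), ((n + 1).choose i : R[X]) * momentPoly R i := by
  induction n with
  | zero => simp [momentPoly_succ, momentPoly_zero]; ring
  | succ n ih =>
    set T := ∑ i ∈ Finset.range (n + 1), ((n + 1).choose i : R[X]) * momentPoly R i with hT
    have hder : X * (X - 1) * derivative T
        = ∑ i ∈ Finset.range (n + 1), ((n + 1).choose i : R[X]) * momentPoly R (i + 1) := by
      rw [hT, derivative_sum, Finset.mul_sum]
      refine Finset.sum_congr rfl fun i _ => ?_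
      rw [derivative_natCast_mul, momentPoly_succ]
      ring
    have hsplit : ∑ i ∈ Finset.range (n + 2), ((n + 2).choose i : R[X]) * momentPoly R i
        = T + momentPoly R (n + 1)
          + ∑ i ∈ Finset.range (n + 1), ((n + 1).choose i : R[X]) * momentPoly R (i + 1) := by
      have h1 : T + momentPoly R (n + 1)
          = ∑ i ∈ Finset.range (n + 2), ((n + 1).choose i : R[X]) * momentPoly R i := by
        rw [Finset.sum_range_succ _ (n + 1)]
        simp [hT]
      rw [h1, Finset.sum_range_succ', Finset.sum_range_succ' _ (n + 1)]
      have h2 : ∀ i, ((n + 2).choose (i + 1) : R[X])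
          = ((n + 1).choose i : R[X]) + ((n + 1).choose (i + 1) : R[X]) := by
        intro i
        rw [← Nat.cast_add, ← Nat.choose_succ_succ']
      simp_rw [h2, add_mul, Finset.sum_add_distrib]
      simp
      ring
    rw [show n + 1 + 1 = n + 2 from rfl, hsplit, ← hder, momentPoly_succ (n + 1)]
    conv_lhs => rw [ih]
    rw [ih]
    simp only [derivative_mul, derivative_sub, derivative_X, derivative_one]
    ring

/-! ### The finite differences `Δ^t 0^j` -/

/-- `∑_{l=0}^t (-1)^{t-l} binom(t,l) l^j`, which is `diffZero t j` for `j ≥ 1`. -/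
def diffZeroFull (t j : ℕ) : ℂ :=
  ∑ l ∈ Finset.range (t + 1), (-1 : ℂ) ^ (t - l) * (t.choose l : ℂ) * (l : ℂ) ^ j

theorem diffZero_eq_diffZeroFull (t j : ℕ) (hj : j ≠ 0) : diffZero t j = diffZeroFull t j := by
  rw [diffZero, diffZeroFull, Finset.sum_range_succ', Nat.cast_zero, zero_pow hj, mul_zero,
    add_zero, Finset.range_eq_Ico, Finset.sum_Ico_add' (fun l : ℕ =>
      (-1 : ℂ) ^ (t - l) * (t.choose l : ℂ) * (l : ℂ) ^ j) 0 t 1]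
  rfl

theorem diffZeroFull_succ (t j : ℕ) :
    diffZeroFull (t + 1) (j + 1) = (t + 1) * (diffZeroFull (t + 1) j + diffZeroFull t j) := by
  have h1 : diffZeroFull (t + 1) (j + 1)
      = ∑ l ∈ Finset.range (t + 1),
          (-1 : ℂ) ^ (t - l) * ((t + 1) * (t.choose l : ℂ)) * ((l + 1 : ℕ) : ℂ) ^ j := by
    rw [diffZeroFull, Finset.sum_range_succ']
    simp only [Nat.cast_zero, zero_pow (Nat.succ_ne_zero j), mul_zero, add_zero]
    refine Finset.sum_congr rfl fun l _ => ?_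
    have h : ((t + 1).choose (l + 1) : ℂ) * (l + 1) = (t + 1) * t.choose l := by
      exact_mod_cast (Nat.add_one_mul_choose_eq t l).symm
    rw [Nat.add_sub_add_right, ← h]
    push_cast
    ring
  have h2 : diffZeroFull (t + 1) j + diffZeroFull t j
      = ∑ l ∈ Finset.range (t + 1),
          (-1 : ℂ) ^ (t - l) * (t.choose l : ℂ) * ((l + 1 : ℕ) : ℂ) ^ j := by
    -- The sum for t is extended by the vanishing term binom(t, t+1) and its sign is flipped, so
    -- that Pascal's rule applies termwise.
    have h3 : diffZeroFull t j = - ∑ l ∈ Finset.range (t + 2),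
        (-1 : ℂ) ^ (t + 1 - l) * (t.choose l : ℂ) * (l : ℂ) ^ j := by
      rw [Finset.sum_range_succ, Nat.choose_succ_self, diffZeroFull]
      simp only [Nat.cast_zero, mul_zero, zero_mul, add_zero, ← Finset.sum_neg_distrib]
      refine Finset.sum_congr rfl fun l hl => ?_
      rw [Nat.sub_add_comm (Nat.lt_succ_iff.mp (Finset.mem_range.mp hl)), pow_succ]
      ring
    rw [h3, diffZeroFull, ← sub_eq_add_neg, ← Finset.sum_sub_distrib, Finset.sum_range_succ']
    simp only [Nat.choose_zero_right, sub_self, add_zero, Nat.add_sub_add_right]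
    refine Finset.sum_congr rfl fun l _ => ?_
    rw [Nat.choose_succ_succ']
    push_cast
    ring
  rw [h1, h2, Finset.mul_sum]
  exact Finset.sum_congr rfl fun l _ => by ring

theorem diffZeroFull_zero_succ (j : ℕ) : diffZeroFull 0 (j + 1) = 0 := by
  simp [diffZeroFull]

theorem diffZeroFull_eq_zero {t j : ℕ} (h : j < t) : diffZeroFull t j = 0 := by
  induction j generalizing t with
  | zero =>
    obtain ⟨t, rfl⟩ := Nat.exists_eq_succ_of_ne_zero (Nat.pos_iff_ne_zero.mp h)
    have h1 := (add_pow (1 : ℂ) (-1) (t + 1)).symm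
    rw [add_neg_cancel, zero_pow (Nat.succ_ne_zero t)] at h1
    simp only [diffZeroFull, pow_zero, mul_one]
    rw [← h1]
    exact Finset.sum_congr rfl fun l _ => by simp
  | succ j ih =>
    obtain ⟨t, rfl⟩ := Nat.exists_eq_succ_of_ne_zero (Nat.ne_of_gt (Nat.zero_lt_of_lt h))
    rw [diffZeroFull_succ, ih (by omega), ih (by omega)]
    simp

theorem diffZeroFull_self (n : ℕ) : diffZeroFull n n = n.factorial := by
  induction n with
  | zero => simp [diffZeroFull]
  | succ n ih =>
    rw [diffZeroFull_succ, ih, diffZeroFull_eq_zero (Nat.lt_succ_self n), Nat.factorial_succ]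
    push_cast
    ring

/-- The operator X(X-1) d/dX sends X(X-1)^t to t X(X-1)^t + (t+1) X(X-1)^{t+1}, which is the
recurrence `diffZeroFull_succ` of the differences. -/
theorem momentPoly_eq_sum_diffZeroFull (n : ℕ) :
    momentPoly ℂ n = ∑ t ∈ Finset.range (n + 1), C (diffZeroFull t n) * (X * (X - 1) ^ t) := by
  induction n with
  | zero => simp [momentPoly_zero, diffZeroFull]
  | succ n ih =>
    rw [momentPoly_succ, ih, derivative_sum, Finset.mul_sum, Finset.sum_range_succ' _ (n + 1),
      diffZeroFull_zero_succ, C_0, zero_mul, add_zero]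
    have h1 : ∀ t, X * (X - 1) * derivative (C (diffZeroFull t n) * (X * (X - 1) ^ t))
        = C (t * diffZeroFull t n) * (X * (X - 1) ^ t)
          + C ((t + 1) * diffZeroFull t n) * (X * (X - 1) ^ (t + 1)) := by
      intro t
      rw [derivative_C_mul]
      rcases t with _ | t
      · simp; ring
      · simp [derivative_mul, derivative_pow]
        ring
    simp_rw [h1, Finset.sum_add_distrib]
    have h2 : ∑ t ∈ Finset.range (n + 1), C (t * diffZeroFull t n) * (X * (X - 1) ^ t : ℂ[X])
        = ∑ t ∈ Finset.range (n + 1),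
          C ((t + 1) * diffZeroFull (t + 1) n) * (X * (X - 1) ^ (t + 1)) := by
      rw [Finset.sum_range_succ', Finset.sum_range_succ, diffZeroFull_eq_zero (Nat.lt_succ_self n)]
      simp
    rw [h2, ← Finset.sum_add_distrib]
    refine Finset.sum_congr rfl fun t _ => ?_
    rw [diffZeroFull_succ]
    simp only [C_mul, C_add]
    ring

theorem momentPoly_eval_eq_sum_diffZero (n : ℕ) (hn : n ≠ 0) (s : ℂ) :
    (momentPoly ℂ n).eval s = ∑ t ∈ Finset.Icc 1 n, diffZero t n * (s * (s - 1) ^ t) := by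
  obtain ⟨n, rfl⟩ := Nat.exists_eq_succ_of_ne_zero hn
  rw [momentPoly_eq_sum_diffZeroFull, eval_finsetSum, Nat.succ_eq_add_one,
    Finset.sum_range_succ', diffZeroFull_zero_succ]
  simp only [C_0, zero_mul, eval_zero, add_zero]
  rw [Finset.range_eq_Ico, Finset.sum_Ico_add' (fun t : ℕ =>
      eval s (C (diffZeroFull t (n + 1)) * (X * (X - 1) ^ t))) 0 (n + 1) 1]
  refine Finset.sum_congr rfl fun t _ => ?_
  rw [diffZero_eq_diffZeroFull _ _ hn]
  simp

/-! ### Linear independence -/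

/-- G_t is t! X(X-1)^t plus terms with smaller exponents, so the relations can be cleared
triangularly to Vandermonde relations in the distinct numbers s_i - 1, with unknowns α_i s_i. -/
theorem eq_zero_of_sum_momentPoly_eq_zero {ι : Type*} [Fintype ι] {s α : ι → ℂ}
    (hs : Function.Injective s) (hs0 : ∀ i, s i ≠ 0)
    (h : ∀ n < Fintype.card ι, ∑ i, α i * (momentPoly ℂ n).eval (s i) = 0) : α = 0 := by
  have key : ∀ t < Fintype.card ι, ∑ i, (α i * s i) * (s i - 1) ^ t = 0 := by
    intro t
    induction t using Nat.strong_induction_on with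
    | _ t ih =>
      intro ht
      have h1 := h t ht
      rw [momentPoly_eq_sum_diffZeroFull] at h1
      simp only [eval_finsetSum, eval_mul, eval_C, eval_X, eval_pow, eval_sub, eval_one,
        Finset.mul_sum] at h1
      rw [Finset.sum_comm, Finset.sum_range_succ, Finset.sum_eq_zero, zero_add] at h1
      · have h2 : ∑ i, α i * (diffZeroFull t t * (s i * (s i - 1) ^ t))
            = diffZeroFull t t * ∑ i, (α i * s i) * (s i - 1) ^ t := by
          rw [Finset.mul_sum]
          exact Finset.sum_congr rfl fun i _ => by ring
        rw [h2, diffZeroFull_self] at h1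
        exact (mul_eq_zero.mp h1).resolve_left (by exact_mod_cast Nat.factorial_ne_zero t)
      · intro u hu
        have hu' := Finset.mem_range.mp hu
        rw [← mul_zero (diffZeroFull u t), ← ih u hu' (hu'.trans ht), Finset.mul_sum]
        exact Finset.sum_congr rfl fun i _ => by ring
  let e := (Fintype.equivFin ι).symm
  have h3 : (fun j => α (e j) * s (e j)) = 0 := by
    refine Matrix.eq_zero_of_forall_pow_sum_mul_pow_eq_zero (f := fun j => s (e j) - 1) ?_ ?_
    · intro i j hij
      exact e.injective (hs (sub_left_injective hij))
    · intro i
      rw [← key i i.2]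
      exact e.sum_comp (fun i' => (α i' * s i') * (s i' - 1) ^ (i : ℕ))
  funext i
  have h4 := congrFun h3 (e.symm i)
  simp only [Equiv.apply_symm_apply, Pi.zero_apply] at h4
  exact (mul_eq_zero.mp h4).resolve_right (hs0 i)

end algebra

/-! ### Roots of the Euler-Frobenius polynomials -/

section roots

open Polynomial

/-- In the variable s = x/(x-1) the operator x d/dx becomes -s(s-1) d/ds, and x/(1-x)² becomes
s(s-1) = G_1(s). -/
theorem momentPoly_eval_iterate_xDeriv (k : ℕ) : ∀ x : ℂ, x ≠ 1 →
    (xDeriv^[k] (fun y => y / (1 - y) ^ 2)) x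
      = (-1) ^ k * (momentPoly ℂ (k + 1)).eval (x / (x - 1)) := by
  induction k with
  | zero =>
    intro x hx
    have h1 : x - 1 ≠ 0 := sub_ne_zero.mpr hx
    have h2 : 1 - x ≠ 0 := sub_ne_zero.mpr hx.symm
    simp [momentPoly_succ, momentPoly_zero]
    field_simp
    ring
  | succ k ih =>
    intro x hx
    have h1 : x - 1 ≠ 0 := sub_ne_zero.mpr hx
    rw [Function.iterate_succ_apply']
    have hev : (xDeriv^[k] (fun y => y / (1 - y) ^ 2)) =ᶠ[nhds x]
        fun y => (-1) ^ k * (momentPoly ℂ (k + 1)).eval (y / (y - 1)) := by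
      filter_upwards [isOpen_ne.mem_nhds hx] with y hy using ih y hy
    have hq : HasDerivAt (fun y : ℂ => y / (y - 1))
        ((1 * (x - 1) - x * 1) / (x - 1) ^ 2) x :=
      (hasDerivAt_id x).div ((hasDerivAt_id x).sub_const 1) h1
    have hd : HasDerivAt (fun y : ℂ => (-1) ^ k * (momentPoly ℂ (k + 1)).eval (y / (y - 1)))
        ((-1) ^ k * ((derivative (momentPoly ℂ (k + 1))).eval (x / (x - 1))
          * ((1 * (x - 1) - x * 1) / (x - 1) ^ 2))) x :=
      (((momentPoly ℂ (k + 1)).hasDerivAt (x / (x - 1))).comp x hq).const_mul ((-1 : ℂ) ^ k)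
    simp only [xDeriv]
    rw [hev.deriv_eq, hd.deriv, momentPoly_succ (k + 1)]
    simp only [eval_mul, eval_sub, eval_X, eval_one]
    field_simp
    ring

theorem momentPoly_eval_mul_pow (k : ℕ) (x : ℂ) (hx : x ≠ 1) :
    (momentPoly ℂ (k + 1)).eval (x / (x - 1)) * (x - 1) ^ (k + 2)
      = x * (eulerFrobenius k).eval x := by
  have h2 : 1 - x ≠ 0 := sub_ne_zero.mpr hx.symm
  have h := (momentPoly_eval_iterate_xDeriv k x hx).symm.trans (iterate_xDeriv k x hx)
  rw [eq_div_iff (pow_ne_zero _ h2)] at h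
  rw [← h, show 1 - x = (-1) * (x - 1) by ring, mul_pow (-1 : ℂ), pow_add (-1 : ℂ) k 2]
  have h3 : ((-1 : ℂ) ^ k) * (-1) ^ k = 1 := by rw [← mul_pow]; simp
  linear_combination (-(momentPoly ℂ (k + 1)).eval (x / (x - 1)) * (x - 1) ^ (k + 2)) * h3

theorem eulerFrobenius_eval_zero (k : ℕ) : (eulerFrobenius k).eval 0 = 1 := by
  induction k with
  | zero => simp [eulerFrobenius]
  | succ k ih => simp [eulerFrobenius, ih]

theorem eulerFrobenius_eval_one (k : ℕ) : (eulerFrobenius k).eval 1 = ((k + 1).factorial : ℂ) := by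
  induction k with
  | zero => simp [eulerFrobenius]
  | succ k ih =>
    simp only [eulerFrobenius, eval_add, eval_mul, eval_sub, eval_one, eval_X, eval_natCast, ih,
      Nat.factorial_succ (k + 1)]
    push_cast
    ring

theorem eulerFrobenius_isRoot_iff (k : ℕ) (z : ℂ) :
    (eulerFrobenius k).eval z = 0 ↔
      z ≠ 0 ∧ z ≠ 1 ∧ (momentPoly ℂ (k + 1)).eval (z / (z - 1)) = 0 := by
  constructor
  · intro h
    have h0 : z ≠ 0 := by
      rintro rfl
      rw [eulerFrobenius_eval_zero] at h
      exact one_ne_zero h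
    have h1 : z ≠ 1 := by
      rintro rfl
      rw [eulerFrobenius_eval_one] at h
      exact Nat.factorial_ne_zero _ (by exact_mod_cast h)
    have h2 := momentPoly_eval_mul_pow k z h1
    rw [h, mul_zero] at h2
    exact ⟨h0, h1, (mul_eq_zero.mp h2).resolve_right (pow_ne_zero _ (sub_ne_zero.mpr h1))⟩
  · rintro ⟨h0, h1, h⟩
    have h2 := momentPoly_eval_mul_pow k z h1
    rw [h, zero_mul] at h2
    exact (mul_eq_zero.mp h2.symm).resolve_left h0

/-- `r ↦ r / (r - 1)` is an involution. -/
theorem div_sub_one_involutive {z : ℂ} (h1 : z ≠ 1) : (z / (z - 1)) / (z / (z - 1) - 1) = z := by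
  have h : z - 1 ≠ 0 := sub_ne_zero.mpr h1
  have h2 : z / (z - 1) - 1 = 1 / (z - 1) := by field_simp; ring
  rw [h2]
  field_simp

theorem inv_div_inv_sub_one {z : ℂ} (h0 : z ≠ 0) (h1 : z ≠ 1) :
    z⁻¹ / (z⁻¹ - 1) = 1 - z / (z - 1) := by
  have h : z - 1 ≠ 0 := sub_ne_zero.mpr h1
  have h' : 1 - z ≠ 0 := sub_ne_zero.mpr h1.symm
  have h2 : z⁻¹ - 1 = (1 - z) / z := by field_simp
  rw [h2]
  field_simp
  ring

theorem eulerFrobenius_eval_inv (k : ℕ) (z : ℂ) (h : (eulerFrobenius k).eval z = 0) :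
    (eulerFrobenius k).eval z⁻¹ = 0 := by
  obtain ⟨h0, h1, h2⟩ := (eulerFrobenius_isRoot_iff k z).mp h
  refine (eulerFrobenius_isRoot_iff k _).mpr ⟨inv_ne_zero h0, by simpa using h1, ?_⟩
  rw [inv_div_inv_sub_one h0 h1, momentPoly_eval_one_sub, h2, mul_zero]

/-- Rolle's theorem gives G_{n+1}' at least n+1 roots that are not roots of G_{n+1}, in particular
different from 0 and 1. The factor X(X-1) of G_{n+2} contributes these last two. -/
theorem momentPoly_real_roots (n : ℕ) :
    (({0, 1} : Finset ℝ) ⊆ (momentPoly ℝ (n + 1)).roots.toFinset) ∧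
      n + 2 ≤ (momentPoly ℝ (n + 1)).roots.toFinset.card := by
  have hsub : ∀ n, ({0, 1} : Finset ℝ) ⊆ (momentPoly ℝ (n + 1)).roots.toFinset := by
    intro n x hx
    rw [Multiset.mem_toFinset, mem_roots (momentPoly_ne_zero _), IsRoot.def, momentPoly_succ]
    rcases Finset.mem_insert.mp hx with rfl | hx
    · simp
    · rw [Finset.mem_singleton.mp hx]; simp
  refine ⟨hsub n, ?_⟩
  induction n with
  | zero => exact (Finset.card_pair zero_ne_one).symm.le.trans (Finset.card_le_card (hsub 0))
  | succ n ih =>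
    have hrolle := card_roots_toFinset_le_card_roots_derivative_sdiff_roots_succ
      (momentPoly ℝ (n + 1))
    set D := (derivative (momentPoly ℝ (n + 1))).roots.toFinset \
      (momentPoly ℝ (n + 1)).roots.toFinset with hD
    have hdisj : Disjoint ({0, 1} : Finset ℝ) D :=
      Finset.disjoint_of_subset_left (hsub n) Finset.disjoint_sdiff
    have hle : ({0, 1} : Finset ℝ) ∪ D ⊆ (momentPoly ℝ (n + 2)).roots.toFinset := by
      refine Finset.union_subset (hsub (n + 1)) fun x hx => ?_
      have hx' := (Finset.mem_sdiff.mp hx).1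
      rw [Multiset.mem_toFinset] at hx' ⊢
      rw [mem_roots (momentPoly_ne_zero _), IsRoot.def, momentPoly_succ, eval_mul,
        (isRoot_of_mem_roots hx').eq_zero, mul_zero]
    have h := Finset.card_le_card hle
    rw [Finset.card_union_of_disjoint hdisj, Finset.card_pair zero_ne_one] at h
    show n + 1 + 2 ≤ (momentPoly ℝ (n + 2)).roots.toFinset.card
    omega

/-- The degree is at most n+2, so the real roots found by Rolle exhaust the complex ones. -/
theorem momentPoly_complex_roots (n : ℕ) :
    (momentPoly ℂ (n + 1)).roots.toFinset
        = (momentPoly ℝ (n + 1)).roots.toFinset.map ⟨_, Complex.ofReal_injective⟩ ∧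
      (momentPoly ℂ (n + 1)).roots.toFinset.card = n + 2 := by
  obtain ⟨-, h⟩ := momentPoly_real_roots n
  have hsub : (momentPoly ℝ (n + 1)).roots.toFinset.map ⟨_, Complex.ofReal_injective⟩
      ⊆ (momentPoly ℂ (n + 1)).roots.toFinset := by
    intro z hz
    obtain ⟨x, hx, rfl⟩ := Finset.mem_map.mp hz
    rw [Multiset.mem_toFinset] at hx ⊢
    rw [mem_roots (momentPoly_ne_zero _), IsRoot.def, ← momentPoly_map Complex.ofRealHom]
    have h2 := (isRoot_of_mem_roots hx).eq_zero
    have h3 := eval_map_apply (f := Complex.ofRealHom) (p := momentPoly ℝ (n + 1)) x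
    rw [h2, map_zero] at h3
    exact h3
  have hcard : (momentPoly ℂ (n + 1)).roots.toFinset.card ≤ n + 2 :=
    (Multiset.toFinset_card_le _).trans ((card_roots' _).trans (momentPoly_natDegree_le _))
  have heq := Finset.eq_of_subset_of_card_le hsub (by rw [Finset.card_map]; exact hcard.trans h)
  refine ⟨heq.symm, le_antisymm hcard ?_⟩
  rw [← heq, Finset.card_map]
  exact h

theorem eulerFrobenius_ne_zero (k : ℕ) : eulerFrobenius k ≠ 0 := by
  intro h
  have := eulerFrobenius_eval_zero k
  simp [h] at this

theorem mem_eulerFrobenius_roots {k : ℕ} {z : ℂ} :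
    z ∈ (eulerFrobenius k).roots.toFinset ↔ (eulerFrobenius k).eval z = 0 := by
  rw [Multiset.mem_toFinset, mem_roots (eulerFrobenius_ne_zero k), IsRoot.def]

theorem mem_momentPoly_roots {k : ℕ} {z : ℂ} :
    z ∈ (momentPoly ℂ k).roots.toFinset ↔ (momentPoly ℂ k).eval z = 0 := by
  rw [Multiset.mem_toFinset, mem_roots (momentPoly_ne_zero k), IsRoot.def]

/-- All the roots of `E_k` are real. -/
theorem eulerFrobenius_root_real {k : ℕ} {z : ℂ} (h : (eulerFrobenius k).eval z = 0) :
    ∃ x : ℝ, z = x := by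
  obtain ⟨h0, h1, h2⟩ := (eulerFrobenius_isRoot_iff k z).mp h
  rw [← mem_momentPoly_roots, (momentPoly_complex_roots k).1] at h2
  obtain ⟨x, -, hx⟩ := Finset.mem_map.mp h2
  refine ⟨x / (x - 1), ?_⟩
  rw [← div_sub_one_involutive h1, ← hx]
  simp

/-- `E_k` has `k` distinct roots. -/
theorem card_eulerFrobenius_roots (k : ℕ) : (eulerFrobenius k).roots.toFinset.card = k := by
  -- The involution z ↦ z/(z-1) matches the roots of E_k with the roots of G_{k+1} other than 0 and
  -- 1, which number (k+2) - 2.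
  have h : (eulerFrobenius k).roots.toFinset.card
      = (((momentPoly ℂ (k + 1)).roots.toFinset.erase 0).erase 1).card := by
    refine Finset.card_bij' (fun z _ => z / (z - 1)) (fun z _ => z / (z - 1)) ?_ ?_ ?_ ?_
    · intro z hz
      obtain ⟨h0, h1, h2⟩ := (eulerFrobenius_isRoot_iff k z).mp (mem_eulerFrobenius_roots.mp hz)
      have h3 : z - 1 ≠ 0 := sub_ne_zero.mpr h1
      refine Finset.mem_erase.mpr ⟨?_, Finset.mem_erase.mpr
        ⟨div_ne_zero h0 h3, mem_momentPoly_roots.mpr h2⟩⟩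
      intro h4
      rw [div_eq_one_iff_eq h3] at h4
      exact one_ne_zero (sub_eq_self.mp h4.symm)
    · intro s hs
      obtain ⟨h1, hs'⟩ := Finset.mem_erase.mp hs
      obtain ⟨h0, h2⟩ := Finset.mem_erase.mp hs'
      have h3 : s - 1 ≠ 0 := sub_ne_zero.mpr h1
      refine mem_eulerFrobenius_roots.mpr ((eulerFrobenius_isRoot_iff k _).mpr
        ⟨div_ne_zero h0 h3, ?_, ?_⟩)
      · intro h4
        rw [div_eq_one_iff_eq h3] at h4
        exact one_ne_zero (sub_eq_self.mp h4.symm)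
      · rw [div_sub_one_involutive h1]
        exact mem_momentPoly_roots.mp h2
    · intro z hz
      exact div_sub_one_involutive
        ((eulerFrobenius_isRoot_iff k z).mp (mem_eulerFrobenius_roots.mp hz)).2.1
    · intro s hs
      exact div_sub_one_involutive (Finset.mem_erase.mp hs).1
  have h0 : (0 : ℂ) ∈ (momentPoly ℂ (k + 1)).roots.toFinset := by
    rw [mem_momentPoly_roots, momentPoly_succ]; simp
  have h1 : (1 : ℂ) ∈ (momentPoly ℂ (k + 1)).roots.toFinset.erase 0 := by
    rw [Finset.mem_erase, mem_momentPoly_roots, momentPoly_succ]; simp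
  rw [h, Finset.card_erase_of_mem h1, Finset.card_erase_of_mem h0, (momentPoly_complex_roots k).2]
  omega

/-- `E_{2n}` has exactly `n` roots in the open unit disc. -/
theorem card_eulerFrobenius_roots_inside (n : ℕ) :
    ((eulerFrobenius (2 * n)).roots.toFinset.filter (fun z => ‖z‖ < 1)).card = n := by
  set Z := (eulerFrobenius (2 * n)).roots.toFinset with hZ
  have hcard : Z.card = 2 * n := card_eulerFrobenius_roots _
  have hinv : ∀ z ∈ Z, z ≠ 0 ∧ z⁻¹ ∈ Z := fun z hz =>
    ⟨((eulerFrobenius_isRoot_iff _ z).mp (mem_eulerFrobenius_roots.mp hz)).1,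
      mem_eulerFrobenius_roots.mpr (eulerFrobenius_eval_inv _ z (mem_eulerFrobenius_roots.mp hz))⟩
  have hio : (Z.filter (fun z => ‖z‖ < 1)).card = (Z.filter (fun z => 1 < ‖z‖)).card := by
    refine Finset.card_bij' (fun z _ => z⁻¹) (fun z _ => z⁻¹) ?_ ?_ ?_ ?_
    · intro z hz
      obtain ⟨h1, h2⟩ := Finset.mem_filter.mp hz
      refine Finset.mem_filter.mpr ⟨(hinv z h1).2, ?_⟩
      rw [norm_inv]
      exact (one_lt_inv₀ (norm_pos_iff.mpr (hinv z h1).1)).mpr h2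
    · intro z hz
      obtain ⟨h1, h2⟩ := Finset.mem_filter.mp hz
      refine Finset.mem_filter.mpr ⟨(hinv z h1).2, ?_⟩
      rw [norm_inv]
      exact inv_lt_one_of_one_lt₀ h2
    · intro z _; exact inv_inv z
    · intro z _; exact inv_inv z
  -- A root is real and different from 1, so only -1 can lie on the circle. Since the total 2n is
  -- twice the number inside plus this count, parity forces the count to be 0.
  have hon : (Z.filter (fun z => ‖z‖ = 1)).card ≤ 1 := by
    have hm : ∀ z ∈ Z.filter (fun z => ‖z‖ = 1), z = -1 := by
      intro z hz
      obtain ⟨h1, h2⟩ := Finset.mem_filter.mp hz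
      have h3 := mem_eulerFrobenius_roots.mp h1
      obtain ⟨x, rfl⟩ := eulerFrobenius_root_real h3
      have h4 := ((eulerFrobenius_isRoot_iff _ _).mp h3).2.1
      rw [Complex.norm_real, Real.norm_eq_abs] at h2
      rcases abs_eq_abs.mp (h2.trans abs_one.symm) with rfl | rfl
      · simp at h4
      · simp
    exact Finset.card_le_one.mpr fun x hx y hy => (hm x hx).trans (hm y hy).symm
  have hsplit : Z.card = (Z.filter (fun z => ‖z‖ < 1)).card
      + ((Z.filter (fun z => ‖z‖ = 1)).card + (Z.filter (fun z => 1 < ‖z‖)).card) := by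
    rw [← Finset.card_filter_add_card_filter_not (s := Z) (fun z => ‖z‖ < 1)]
    congr 1
    rw [← Finset.card_union_of_disjoint]
    · congr 1
      ext z
      simp only [Finset.mem_filter, Finset.mem_union, not_lt, le_iff_eq_or_lt]
      grind
    · rw [Finset.disjoint_filter]
      intro z _ h1 h2
      linarith
  omega

theorem exists_isRootList (m : ℕ) : ∃ q : Fin (m - 1) → ℂ, IsRootList m q := by
  have hcard := card_eulerFrobenius_roots_inside (m - 1)
  rw [show 2 * (m - 1) = 2 * m - 2 by omega] at hcard
  let e := (Finset.equivFinOfCardEq hcard).symm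
  refine ⟨fun k => e k, fun i j hij => e.injective (Subtype.ext hij), fun z => ?_⟩
  rw [← mem_eulerFrobenius_roots, ← Finset.mem_filter
    (p := fun z : ℂ => ‖z‖ < 1)]
  constructor
  · intro hz
    exact ⟨e.symm ⟨z, hz⟩, by simp⟩
  · rintro ⟨k, rfl⟩
    exact (e k).2

end roots

/-! ### Exponential Euler polynomials -/

section appell

open Polynomial

/-- `H_n(y) = ∑_i binom(n,i) G_i(s) y^{n-i}`. -/
def appell (s : ℂ) (n : ℕ) : ℂ[X] :=
  ∑ i ∈ Finset.range (n + 1), C ((n.choose i : ℂ) * (momentPoly ℂ i).eval s) * X ^ (n - i)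

theorem appell_eval_zero (s : ℂ) (n : ℕ) : (appell s n).eval 0 = (momentPoly ℂ n).eval s := by
  rw [appell, eval_finsetSum, Finset.sum_range_succ, Finset.sum_eq_zero]
  · simp
  · intro i hi
    have : n - i ≠ 0 := by have := Finset.mem_range.mp hi; omega
    simp [this]

theorem derivative_appell (s : ℂ) (n : ℕ) :
    derivative (appell s (n + 1)) = C ((n + 1 : ℕ) : ℂ) * appell s n := by
  rw [appell, derivative_sum, Finset.sum_range_succ, appell, Finset.mul_sum]
  simp only [Nat.sub_self, pow_zero, mul_one, derivative_C, add_zero]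
  refine Finset.sum_congr rfl fun i hi => ?_
  have hi' : i ≤ n := Nat.lt_succ_iff.mp (Finset.mem_range.mp hi)
  have h : ((n + 1).choose i : ℂ) * ((n + 1 - i : ℕ) : ℂ) = ((n + 1 : ℕ) : ℂ) * n.choose i := by
    rw [mul_comm _ (n.choose i : ℂ)]
    exact_mod_cast (Nat.choose_mul_succ_eq n i).symm
  rw [derivative_C_mul, derivative_X_pow, ← mul_assoc, ← C_mul, ← mul_assoc, ← C_mul]
  rw [show n + 1 - i - 1 = n - i by omega]
  congr 2
  linear_combination (momentPoly ℂ i).eval s * h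

theorem appell_eval_one (s : ℂ) (n : ℕ) :
    (s - 1) * (appell s n).eval 1 = s * (momentPoly ℂ n).eval s - s * 0 ^ n := by
  rcases n with _ | n
  · simp [appell, momentPoly_zero]; ring
  · have h := congrArg (eval s) (momentPoly_recurrence (R := ℂ) n)
    simp only [eval_mul, eval_sub, eval_X, eval_one, eval_finsetSum, eval_natCast] at h
    rw [appell, eval_finsetSum, Finset.sum_range_succ]
    simp only [eval_mul, eval_C, eval_pow, eval_X, one_pow, mul_one, Nat.choose_self, Nat.cast_one,
      one_mul, mul_add]
    rw [← h]
    simp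
    ring

/-- For s = r/(r-1) this is H_n(y+1) = r H_n(y) - r y^n. The derivative of the defect is a multiple
of the defect for n-1, so by induction the defect is constant, and `appell_eval_one` makes it vanish
at 0. -/
theorem appell_add_one (s : ℂ) (n : ℕ) :
    C (s - 1) * (appell s n).comp (X + 1) = C s * appell s n - C s * X ^ n := by
  have hconst : ∀ P : ℂ[X], derivative P = 0 → P.eval 0 = 0 → P = 0 := by
    intro P h1 h2
    obtain ⟨c, rfl⟩ := natDegree_eq_zero.mp (derivative_eq_zero.mp h1)
    simpa using h2
  rw [← sub_eq_zero]
  induction n with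
  | zero =>
    simp [appell, momentPoly_zero]
    ring
  | succ n ih =>
    apply hconst
    · rw [← mul_zero (C ((n + 1 : ℕ) : ℂ)), ← ih]
      simp only [derivative_sub, derivative_C_mul, derivative_comp, derivative_appell,
        derivative_X_pow, derivative_add, derivative_X, derivative_one, mul_comp, C_comp,
        Nat.add_sub_cancel]
      ring
    · have h := appell_eval_one s (n + 1)
      simp only [eval_sub, eval_mul, eval_C, eval_comp, eval_add, eval_X, eval_one, zero_add,
        eval_pow, appell_eval_zero]
      rw [h]
      ring

/-- The functional equation iterated β times. The subtracted sum is what the truncated powers of the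
spline will compensate, leaving the pure multiplier r^β. -/
theorem appell_eval_natCast {r : ℂ} (hr : r ≠ 1) (n β : ℕ) :
    (appell (r / (r - 1)) n).eval (β : ℂ)
      = r ^ β * (momentPoly ℂ n).eval (r / (r - 1))
        - ∑ γ ∈ Finset.range β, r ^ (γ + 1) * ((β : ℂ) - (γ + 1 : ℕ)) ^ n := by
  have h1 : r - 1 ≠ 0 := sub_ne_zero.mpr hr
  induction β with
  | zero => simp [appell_eval_zero]
  | succ β ih =>
    have h := congrArg (eval (β : ℂ)) (appell_add_one (r / (r - 1)) n)
    simp only [eval_sub, eval_mul, eval_C, eval_comp, eval_add, eval_X, eval_one, eval_pow] at h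
    have h2 : r / (r - 1) - 1 = 1 / (r - 1) := by field_simp; ring
    have h3 : (appell (r / (r - 1)) n).eval ((β : ℂ) + 1)
        = r * (appell (r / (r - 1)) n).eval (β : ℂ) - r * (β : ℂ) ^ n := by
      generalize (appell (r / (r - 1)) n) = P at h ⊢
      rw [h2] at h
      field_simp at h
      linear_combination h
    rw [Nat.cast_succ, h3, ih, Finset.sum_range_succ']
    simp only [pow_succ, mul_sub, Finset.mul_sum]
    have h4 : ∀ γ : ℕ, ((β : ℂ) + 1 - ((γ + 1 + 1 : ℕ) : ℂ)) = (β : ℂ) - ((γ + 1 : ℕ) : ℂ) := by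
      intro γ; push_cast; ring
    simp_rw [h4]
    have h5 : ∀ γ : ℕ, r * (r ^ γ * r * ((β : ℂ) - ((γ + 1 : ℕ) : ℂ)) ^ n)
        = r ^ γ * r * r * ((β : ℂ) - ((γ + 1 : ℕ) : ℂ)) ^ n := fun γ => by ring
    simp_rw [h5]
    simp
    ring

end appell

/-! ### Absolutely continuous complex functions -/

section absolutelyContinuous

open Set Filter

theorem _root_.LipschitzWith.comp_absolutelyContinuousOnInterval {X Y : Type*}
    [PseudoMetricSpace X] [PseudoMetricSpace Y] {f : ℝ → X} {g : X → Y} {a b : ℝ}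
    (hg : LipschitzWith 1 g) (hf : AbsolutelyContinuousOnInterval f a b) :
    AbsolutelyContinuousOnInterval (fun x => g (f x)) a b := by
  refine squeeze_zero (fun t => Finset.sum_nonneg fun i _ => dist_nonneg)
    (fun t => Finset.sum_le_sum fun i _ => ?_) hf
  simpa using hg.dist_le_mul (f (t.2 i).1) (f (t.2 i).2)

variable {f g f' g' : ℝ → ℂ} {a b : ℝ}

theorem _root_.AbsolutelyContinuousOnInterval.re (hf : AbsolutelyContinuousOnInterval f a b) :
    AbsolutelyContinuousOnInterval (fun x => (f x).re) a b :=
  LipschitzWith.comp_absolutelyContinuousOnInterval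
    (LipschitzWith.of_dist_le_mul fun x y => by
      simpa [Complex.dist_eq, Real.dist_eq] using Complex.abs_re_le_norm (x - y)) hf

theorem _root_.AbsolutelyContinuousOnInterval.im (hf : AbsolutelyContinuousOnInterval f a b) :
    AbsolutelyContinuousOnInterval (fun x => (f x).im) a b :=
  LipschitzWith.comp_absolutelyContinuousOnInterval
    (LipschitzWith.of_dist_le_mul fun x y => by
      simpa [Complex.dist_eq, Real.dist_eq] using Complex.abs_im_le_norm (x - y)) hf

theorem hasDerivAt_re {x : ℝ} {z : ℂ} (h : HasDerivAt f z x) :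
    HasDerivAt (fun x => (f x).re) z.re x :=
  (Complex.reCLM.hasFDerivAt.comp_hasDerivAt x h)

theorem hasDerivAt_im {x : ℝ} {z : ℂ} (h : HasDerivAt f z x) :
    HasDerivAt (fun x => (f x).im) z.im x :=
  (Complex.imCLM.hasFDerivAt.comp_hasDerivAt x h)

/-- The real and imaginary parts are absolutely continuous, so their derivatives are integrable, and
almost everywhere these are the two parts of f'. -/
theorem _root_.AbsolutelyContinuousOnInterval.intervalIntegrable_of_ae_hasDerivAt
    (hf : AbsolutelyContinuousOnInterval f a b)
    (hf' : ∀ᵐ x, x ∈ uIoc a b → HasDerivAt f (f' x) x) :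
    IntervalIntegrable f' volume a b := by
  have hofReal : ∀ u : ℝ → ℝ, IntervalIntegrable u volume a b →
      IntervalIntegrable (fun x => (u x : ℂ)) volume a b := fun u hu => ⟨hu.1.ofReal, hu.2.ofReal⟩
  have h1 := (hofReal _ hf.re.intervalIntegrable_deriv).add
    ((hofReal _ hf.im.intervalIntegrable_deriv).const_mul Complex.I)
  refine h1.congr_ae ?_
  rw [EventuallyEq, ae_restrict_iff' measurableSet_uIoc]
  filter_upwards [hf'] with x hx hxm
  rw [(hasDerivAt_re (hx hxm)).deriv, (hasDerivAt_im (hx hxm)).deriv]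
  simpa [mul_comm] using Complex.re_add_im (f' x)

theorem _root_.AbsolutelyContinuousOnInterval.integral_eq_sub_of_ae_hasDerivAt
    (hf : AbsolutelyContinuousOnInterval f a b)
    (hf' : ∀ᵐ x, x ∈ uIoc a b → HasDerivAt f (f' x) x) :
    ∫ x in a..b, f' x = f b - f a := by
  have hint := hf.intervalIntegrable_of_ae_hasDerivAt hf'
  apply Complex.ext
  · rw [Complex.sub_re, ← hf.re.integral_deriv_eq_sub]
    refine (Complex.reCLM.intervalIntegral_comp_comm hint).symm.trans ?_
    apply intervalIntegral.integral_congr_ae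
    filter_upwards [hf'] with x hx hxm
    rw [(hasDerivAt_re (hx hxm)).deriv]
    rfl
  · rw [Complex.sub_im, ← hf.im.integral_deriv_eq_sub]
    refine (Complex.imCLM.intervalIntegral_comp_comm hint).symm.trans ?_
    apply intervalIntegral.integral_congr_ae
    filter_upwards [hf'] with x hx hxm
    rw [(hasDerivAt_im (hx hxm)).deriv]
    rfl

/-- Integration by parts for absolutely continuous complex functions. -/
theorem integral_mul_eq_of_absolutelyContinuous
    (hf : AbsolutelyContinuousOnInterval f a b)
    (hf' : ∀ᵐ x, x ∈ uIoc a b → HasDerivAt f (f' x) x)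
    (hg : AbsolutelyContinuousOnInterval g a b)
    (hg' : ∀ᵐ x, x ∈ uIoc a b → HasDerivAt g (g' x) x) :
    ∫ x in a..b, f x * g' x = f b * g b - f a * g a - ∫ x in a..b, f' x * g x := by
  have hprod : AbsolutelyContinuousOnInterval (fun x => f x * g x) a b := hf.smul hg
  have h1 := hprod.integral_eq_sub_of_ae_hasDerivAt (f' := fun x => f' x * g x + f x * g' x) (by
    filter_upwards [hf', hg'] with x hx hx2 hxm using (hx hxm).mul (hx2 hxm))
  have hif := hf.intervalIntegrable_of_ae_hasDerivAt hf'
  have hig := hg.intervalIntegrable_of_ae_hasDerivAt hg'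
  rw [intervalIntegral.integral_add (hif.mul_continuousOn hg.continuousOn)
    (hig.continuousOn_mul hf.continuousOn)] at h1
  rw [← h1]
  ring

end absolutelyContinuous

/-! ### The derivatives of an element of the Sobolev space -/

section sobolev

open Set Filter

variable {m : ℕ} {a b : ℝ} {φ : ℝ → ℂ}

theorem derivOn_zero : derivOn a b 0 φ = φ := by
  simp [derivOn]

theorem MemL2m.absolutelyContinuous_derivOn (hab : a < b) (h : MemL2m m a b φ) {i : ℕ}
    (hi : i < m) : AbsolutelyContinuousOnInterval (derivOn a b i φ) a b := by
  rcases (Nat.le_sub_one_of_lt hi).eq_or_lt with rfl | hlt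
  · exact h.absolutelyContinuous
  · apply ContDiffOn.absolutelyContinuousOnInterval
    rw [uIcc_of_le hab.le]
    have h1 : ContDiffOn ℝ ((i + 1 : ℕ) : WithTop ℕ∞) φ (Icc a b) :=
      h.contDiffOn.of_le (by exact_mod_cast hlt)
    exact ((contDiffOn_nat_succ_iff_contDiffOn_one_iteratedDerivWithin
      (uniqueDiffOn_Icc hab)).mp (by exact_mod_cast h1)).2

theorem MemL2m.ae_hasDerivAt_derivOn (hab : a < b) (h : MemL2m m a b φ) {i : ℕ} (hi : i < m) :
    ∀ᵐ x, x ∈ uIoc a b → HasDerivAt (derivOn a b i φ) (derivOn a b (i + 1) φ x) x := by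
  have hac := h.absolutelyContinuous_derivOn hab hi
  -- `derivOn` is only one-sided at b. Discarding this null point leaves interior points, where the
  -- derivative within [a,b] is the ordinary one.
  have hb : ∀ᵐ x : ℝ, x ≠ b := by simp [ae_iff, measure_singleton]
  filter_upwards [hac.boundedVariationOn.ae_differentiableAt_of_mem_uIcc, hb] with x hx hxb hxm
  have hd := hx (uIoc_subset_uIcc hxm)
  rw [uIoc_of_le hab.le] at hxm
  have : derivOn a b (i + 1) φ x = deriv (derivOn a b i φ) x := by
    rw [derivOn, iteratedDerivWithin_succ,
      derivWithin_of_mem_nhds (Icc_mem_nhds hxm.1 (lt_of_le_of_ne hxm.2 hxb))]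
    rfl
  rw [this]
  exact hd.hasDerivAt

end sobolev

/-! ### Truncated powers and exponential splines -/

section spline

open Set Filter

/-- The truncated power `t_+^n / n!`. -/
def truncPow (n : ℕ) (t : ℝ) : ℂ := if 0 < t then (t : ℂ) ^ n / (n.factorial : ℂ) else 0

theorem hasDerivAt_pow_div_factorial (n : ℕ) (t : ℝ) :
    HasDerivAt (fun x : ℝ => (x : ℂ) ^ (n + 1) / ((n + 1).factorial : ℂ))
      ((t : ℂ) ^ n / (n.factorial : ℂ)) t := by
  have h := ((Complex.ofRealCLM.hasDerivAt (x := t)).pow (n + 1)).div_const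
    ((n + 1).factorial : ℂ)
  refine h.congr_deriv ?_
  have h1 : (n.factorial : ℂ) ≠ 0 := by exact_mod_cast Nat.factorial_ne_zero n
  have h2 : (n + 1 : ℂ) ≠ 0 := by exact_mod_cast Nat.succ_ne_zero n
  simp [Nat.factorial_succ]
  field_simp

theorem hasDerivAt_truncPow_of_ne (n : ℕ) {t : ℝ} (ht : t ≠ 0) :
    HasDerivAt (truncPow (n + 1)) (truncPow n t) t := by
  rcases ht.lt_or_gt with h | h
  · rw [truncPow, if_neg h.not_gt]
    refine (hasDerivAt_const t (0 : ℂ)).congr_of_eventuallyEq ?_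
    filter_upwards [gt_mem_nhds h] with x hx
    rw [truncPow, if_neg hx.not_gt]
  · rw [truncPow, if_pos h]
    refine (hasDerivAt_pow_div_factorial n t).congr_of_eventuallyEq ?_
    filter_upwards [lt_mem_nhds h] with x hx
    rw [truncPow, if_pos hx]

theorem norm_truncPow_le (n : ℕ) (t : ℝ) : ‖truncPow n t‖ ≤ |t| ^ n := by
  rw [truncPow]
  split_ifs with h
  · rw [norm_div, norm_pow, Complex.norm_real, Real.norm_eq_abs]
    refine div_le_self (by positivity) ?_
    rw [Complex.norm_natCast]
    exact_mod_cast Nat.one_le_iff_ne_zero.mpr (Nat.factorial_ne_zero n)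
  · rw [norm_zero]; positivity

theorem truncPow_zero_right (n : ℕ) : truncPow n 0 = 0 := by simp [truncPow]

/-- At 0 the bound by |t|^{n+2} is o(t). For `truncPow 1` this fails, hence the case distinctions on
the index further on. -/
theorem hasDerivAt_truncPow (n : ℕ) (t : ℝ) :
    HasDerivAt (truncPow (n + 2)) (truncPow (n + 1) t) t := by
  rcases eq_or_ne t 0 with rfl | ht
  · rw [truncPow_zero_right, hasDerivAt_iff_isLittleO]
    simp only [truncPow_zero_right, sub_zero, smul_zero]
    have h1 : (truncPow (n + 2)) =O[nhds 0] fun t : ℝ => t ^ (n + 2) := by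
      refine Asymptotics.IsBigO.of_bound 1 (Filter.Eventually.of_forall fun t => ?_)
      simpa using norm_truncPow_le (n + 2) t
    refine h1.trans_isLittleO ?_
    simpa using (Asymptotics.isLittleO_pow_pow (𝕜 := ℝ) (show 1 < n + 2 by omega))
  · exact hasDerivAt_truncPow_of_ne _ ht

theorem continuous_truncPow (n : ℕ) : Continuous (truncPow (n + 1)) := by
  rcases n with _ | n
  · have : truncPow (0 + 1) = fun t : ℝ => ((max t 0 : ℝ) : ℂ) := by
      funext t
      rw [truncPow]
      split_ifs with h
      · simp [max_eq_left h.le]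
      · simp [max_eq_right (not_lt.mp h)]
    rw [this]
    fun_prop
  · exact continuous_iff_continuousAt.mpr fun t => (hasDerivAt_truncPow n t).continuousAt

theorem absolutelyContinuous_truncPow (n : ℕ) (ξ a b : ℝ) :
    AbsolutelyContinuousOnInterval (fun x => truncPow (n + 1) (x - ξ)) a b := by
  rcases n with _ | n
  · apply LipschitzOnWith.absolutelyContinuousOnInterval (K := 1)
    refine (LipschitzWith.of_dist_le_mul fun x y => ?_).lipschitzOnWith
    have h : ∀ t, truncPow (0 + 1) t = ((max t 0 : ℝ) : ℂ) := by
      intro t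
      rw [truncPow]
      split_ifs with h
      · simp [max_eq_left h.le]
      · simp [max_eq_right (not_lt.mp h)]
    rw [h, h, Complex.dist_eq, ← Complex.ofReal_sub, Complex.norm_real, Real.norm_eq_abs,
      Real.dist_eq, NNReal.coe_one, one_mul]
    refine (abs_max_sub_max_le_abs _ _ _).trans (le_of_eq ?_)
    congr 1
    ring
  · apply ContDiffOn.absolutelyContinuousOnInterval
    have hd : ∀ x : ℝ, HasDerivAt (fun x => truncPow (n + 2) (x - ξ))
        (truncPow (n + 1) (x - ξ)) x := fun x => by
      simpa using (hasDerivAt_truncPow n (x - ξ)).comp_sub_const x ξ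
    refine ContDiff.contDiffOn (contDiff_one_iff_deriv.mpr
      ⟨fun x => (hd x).differentiableAt, ?_⟩)
    rw [show deriv (fun x => truncPow (n + 2) (x - ξ)) = fun x => truncPow (n + 1) (x - ξ) from
      funext fun x => (hd x).deriv]
    exact (continuous_truncPow n).comp (continuous_sub_right ξ)

variable {ι : Type*} (κ c : ℂ) (a : ℝ) (d : ℕ → ℂ) (S : Finset ι) (w : ι → ℂ) (ξ : ι → ℝ)

/-- An exponential spline: `κ e^{cx}/c^{n+1}` minus a polynomial of degree `n` and truncated powers
of degree `n` at the knots `ξ`. Its derivative is the spline with index `n - 1`. -/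
def expSpline (n : ℕ) (x : ℝ) : ℂ :=
  κ * Complex.exp (c * x) / c ^ (n + 1)
    - ∑ i ∈ Finset.range (n + 1), d i * (((x - a : ℝ) : ℂ) ^ (n - i) / ((n - i).factorial : ℂ))
    - ∑ γ ∈ S, w γ * truncPow n (x - ξ γ)

/-- The smooth part of an exponential spline. -/
def expSmooth (n : ℕ) (x : ℝ) : ℂ :=
  κ * Complex.exp (c * x) / c ^ (n + 1)
    - ∑ i ∈ Finset.range (n + 1), d i * (((x - a : ℝ) : ℂ) ^ (n - i) / ((n - i).factorial : ℂ))

theorem contDiff_expSmooth (n : ℕ) {k : WithTop ℕ∞} : ContDiff ℝ k (expSmooth κ c a d n) := by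
  have hre : ContDiff ℝ k (fun x : ℝ => (x : ℂ)) := Complex.ofRealCLM.contDiff
  have hre' : ContDiff ℝ k (fun x : ℝ => ((x - a : ℝ) : ℂ)) :=
    hre.comp (contDiff_id.sub contDiff_const)
  unfold expSmooth
  refine ContDiff.sub ?_ (ContDiff.sum fun i _ => contDiff_const.mul ((hre'.pow _).div_const _))
  exact ((contDiff_const.mul (contDiff_const.mul hre).cexp)).div_const _

variable {c} in
theorem hasDerivAt_expSmooth (hc : c ≠ 0) (n : ℕ) (x : ℝ) :
    HasDerivAt (expSmooth κ c a d (n + 1)) (expSmooth κ c a d n x) x := by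
  have h1 : HasDerivAt (fun x : ℝ => κ * Complex.exp (c * x) / c ^ (n + 1 + 1))
      (κ * Complex.exp (c * x) / c ^ (n + 1)) x := by
    have h := ((((Complex.ofRealCLM.hasDerivAt (x := x)).const_mul c).cexp).const_mul κ).div_const
      (c ^ (n + 1 + 1))
    refine h.congr_deriv ?_
    simp
    field_simp
    ring
  unfold expSmooth
  refine h1.sub ?_
  simp_rw [Finset.sum_range_succ _ (n + 1)]
  have h2 : HasDerivAt (fun x : ℝ => d (n + 1) * (((x - a : ℝ) : ℂ) ^ (n + 1 - (n + 1))
      / ((n + 1 - (n + 1)).factorial : ℂ))) 0 x := by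
    simpa using hasDerivAt_const x (d (n + 1))
  have h3 := (HasDerivAt.fun_sum (u := Finset.range (n + 1))
    (A := fun i (x : ℝ) => d i * (((x - a : ℝ) : ℂ) ^ (n + 1 - i) / ((n + 1 - i).factorial : ℂ)))
    (A' := fun i => d i * (((x - a : ℝ) : ℂ) ^ (n - i) / ((n - i).factorial : ℂ))) (x := x)
    fun i hi => by
      have hi' : i ≤ n := Nat.lt_succ_iff.mp (Finset.mem_range.mp hi)
      rw [Nat.succ_sub hi']
      exact ((hasDerivAt_pow_div_factorial (n - i) (x - a)).comp_sub_const x a).const_mul (d i)).add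
    h2
  rw [add_zero] at h3
  exact h3

variable {c} in
theorem hasDerivAt_expSpline (hc : c ≠ 0) (n : ℕ) (x : ℝ)
    (h : n ≠ 0 ∨ (∀ γ ∈ S, w γ = 0) ∨ ∀ γ ∈ S, x ≠ ξ γ) :
    HasDerivAt (expSpline κ c a d S w ξ (n + 1)) (expSpline κ c a d S w ξ n x) x := by
  refine (hasDerivAt_expSmooth κ a d hc n x).sub (HasDerivAt.fun_sum fun γ hγ => ?_)
  rcases h with h | h | h
  · obtain ⟨n, rfl⟩ := Nat.exists_eq_succ_of_ne_zero h
    exact ((hasDerivAt_truncPow n (x - ξ γ)).comp_sub_const x (ξ γ)).const_mul (w γ)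
  · rw [h γ hγ]
    simpa using hasDerivAt_const x (0 : ℂ)
  · exact ((hasDerivAt_truncPow_of_ne n (sub_ne_zero.mpr (h γ hγ))).comp_sub_const
      x (ξ γ)).const_mul (w γ)

theorem continuous_expSpline (n : ℕ) (h : n ≠ 0 ∨ ∀ γ ∈ S, w γ = 0) :
    Continuous (expSpline κ c a d S w ξ n) := by
  refine (contDiff_expSmooth κ c a d n (k := 0)).continuous.sub
    (continuous_finsetSum _ fun γ hγ => ?_)
  rcases h with h | h
  · obtain ⟨n, rfl⟩ := Nat.exists_eq_succ_of_ne_zero h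
    exact continuous_const.mul ((continuous_truncPow n).comp (continuous_sub_right _))
  · simp only [h γ hγ, zero_mul]
    exact continuous_const

theorem absolutelyContinuous_expSpline (n : ℕ) (x y : ℝ) :
    AbsolutelyContinuousOnInterval (expSpline κ c a d S w ξ (n + 1)) x y := by
  have hsum : AbsolutelyContinuousOnInterval
      (fun t => ∑ γ ∈ S, w γ * truncPow (n + 1) (t - ξ γ)) x y := by
    classical
    induction S using Finset.induction_on with
    | empty =>
      simp only [Finset.sum_empty]
      exact contDiffOn_const.absolutelyContinuousOnInterval
    | insert i s hi ih =>
      simp only [Finset.sum_insert hi]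
      exact ((absolutelyContinuous_truncPow n (ξ i) x y).const_smul (w i)).add ih
  exact (contDiff_expSmooth κ c a d (n + 1)).contDiffOn.absolutelyContinuousOnInterval.sub hsum

variable {c} in
theorem ae_hasDerivAt_expSpline (hc : c ≠ 0) (n : ℕ) :
    ∀ᵐ x, HasDerivAt (expSpline κ c a d S w ξ (n + 1)) (expSpline κ c a d S w ξ n x) x := by
  have h : ∀ᵐ x : ℝ, x ∉ ξ '' S :=
    (Set.Finite.image ξ S.finite_toSet).countable.ae_notMem volume
  filter_upwards [h] with x hx
  exact hasDerivAt_expSpline κ a d S w ξ hc n x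
    (Or.inr (Or.inr fun γ hγ hxγ => hx ⟨γ, hγ, hxγ.symm⟩))

/-- The step function restricts the integral of φ' to [ξ, b]; this is how point evaluations at the
knots arise. -/
theorem integral_truncPow_zero_mul {φ φ' : ℝ → ℂ} {a b ξ : ℝ} (h1 : a ≤ ξ) (h2 : ξ ≤ b)
    (hφ : AbsolutelyContinuousOnInterval φ a b)
    (hφ' : ∀ᵐ x, x ∈ uIoc a b → HasDerivAt φ (φ' x) x) :
    IntervalIntegrable (fun x => truncPow 0 (x - ξ) * φ' x) volume a b ∧
      ∫ x in a..b, truncPow 0 (x - ξ) * φ' x = φ b - φ ξ := by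
  have hint := hφ.intervalIntegrable_of_ae_hasDerivAt hφ'
  have hsub1 : uIcc a ξ ⊆ uIcc a b := by
    rw [uIcc_of_le h1, uIcc_of_le (h1.trans h2)]; exact Icc_subset_Icc_right h2
  have hsub2 : uIcc ξ b ⊆ uIcc a b := by
    rw [uIcc_of_le h2, uIcc_of_le (h1.trans h2)]; exact Icc_subset_Icc_left h1
  have hsub3 : uIoc ξ b ⊆ uIoc a b := by
    rw [uIoc_of_le h2, uIoc_of_le (h1.trans h2)]; exact Ioc_subset_Ioc_left h1
  have e1 : EqOn (fun _ : ℝ => (0 : ℂ)) (fun x => truncPow 0 (x - ξ) * φ' x) (uIoc a ξ) := by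
    intro x hx
    rw [uIoc_of_le h1] at hx
    simp [truncPow, hx.2.not_gt]
  have e2 : EqOn φ' (fun x => truncPow 0 (x - ξ) * φ' x) (uIoc ξ b) := by
    intro x hx
    rw [uIoc_of_le h2] at hx
    simp [truncPow, hx.1]
  have i1 : IntervalIntegrable (fun x => truncPow 0 (x - ξ) * φ' x) volume a ξ :=
    (intervalIntegrable_const (c := (0 : ℂ))).congr e1
  have i2 : IntervalIntegrable (fun x => truncPow 0 (x - ξ) * φ' x) volume ξ b :=
    (hint.mono_set hsub2).congr e2
  refine ⟨i1.trans i2, ?_⟩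
  rw [← intervalIntegral.integral_add_adjacent_intervals i1 i2,
    ← (hφ.mono hsub2).integral_eq_sub_of_ae_hasDerivAt (f' := φ')
      (by filter_upwards [hφ'] with x hx hxm using hx (hsub3 hxm))]
  have j1 : ∫ x in a..ξ, truncPow 0 (x - ξ) * φ' x = ∫ x in a..ξ, (0 : ℂ) :=
    intervalIntegral.integral_congr_ae (ae_of_all _ fun x hx => (e1 hx).symm)
  have j2 : ∫ x in ξ..b, truncPow 0 (x - ξ) * φ' x = ∫ x in ξ..b, φ' x :=
    intervalIntegral.integral_congr_ae (ae_of_all _ fun x hx => (e2 hx).symm)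
  rw [j1, j2]
  simp

variable {κ c a d S w ξ} in
/-- The action of an exponential spline of index `0` on a derivative. -/
theorem integral_expSpline_zero_mul {φ φ' : ℝ → ℂ} {b : ℝ} (hc : c ≠ 0)
    (hξ : ∀ γ ∈ S, a ≤ ξ γ ∧ ξ γ ≤ b)
    (hφ : AbsolutelyContinuousOnInterval φ a b)
    (hφ' : ∀ᵐ x, x ∈ uIoc a b → HasDerivAt φ (φ' x) x) :
    ∫ x in a..b, expSpline κ c a d S w ξ 0 x * φ' x
      = (κ * Complex.exp (c * b) / c - d 0 - ∑ γ ∈ S, w γ) * φ b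
        + (d 0 - κ * Complex.exp (c * a) / c) * φ a + ∑ γ ∈ S, w γ * φ (ξ γ)
        - κ * ∫ x in a..b, Complex.exp (c * x) * φ x := by
  have hint := hφ.intervalIntegrable_of_ae_hasDerivAt hφ'
  have hexp : ∀ x : ℝ, HasDerivAt (fun x : ℝ => κ * Complex.exp (c * x) / c - d 0)
      (κ * Complex.exp (c * x)) x := by
    intro x
    have h := (((((Complex.ofRealCLM.hasDerivAt (x := x)).const_mul c).cexp).const_mul
      κ).div_const c).sub_const (d 0)
    refine h.congr_deriv ?_
    simp
    field_simp
  have hcont : ContDiff ℝ 1 (fun x : ℝ => κ * Complex.exp (c * x) / c - d 0) := by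
    have hre : ContDiff ℝ 1 (fun x : ℝ => (x : ℂ)) := Complex.ofRealCLM.contDiff
    exact ((contDiff_const.mul (contDiff_const.mul hre).cexp).div_const _).sub contDiff_const
  have hsmooth := integral_mul_eq_of_absolutelyContinuous
    (hcont.contDiffOn.absolutelyContinuousOnInterval (a := a) (b := b))
    (ae_of_all _ fun x _ => hexp x) hφ hφ'
  have htr : ∀ γ ∈ S, _ := fun γ hγ =>
    integral_truncPow_zero_mul (hξ γ hγ).1 (hξ γ hγ).2 hφ hφ'
  have hsplit : ∀ x, expSpline κ c a d S w ξ 0 x * φ' x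
      = (κ * Complex.exp (c * x) / c - d 0) * φ' x
        - ∑ γ ∈ S, w γ * (truncPow 0 (x - ξ γ) * φ' x) := by
    intro x
    simp only [expSpline, zero_add, pow_one, Finset.range_one, Finset.sum_singleton, Nat.sub_zero,
      pow_zero, Nat.factorial_zero, Nat.cast_one, div_one, mul_one]
    rw [sub_mul, Finset.sum_mul]
    congr 1
    exact Finset.sum_congr rfl fun γ _ => by ring
  simp_rw [hsplit]
  have hsumint : IntervalIntegrable (fun x => ∑ γ ∈ S, w γ * (truncPow 0 (x - ξ γ) * φ' x))
      volume a b :=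
    (IntervalIntegrable.sum S fun γ hγ => (htr γ hγ).1.const_mul (w γ)).congr
      fun x _ => by simp
  rw [intervalIntegral.integral_sub (hint.continuousOn_mul hcont.continuous.continuousOn) hsumint,
    intervalIntegral.integral_finsetSum fun γ hγ => (htr γ hγ).1.const_mul (w γ), hsmooth]
  simp only [intervalIntegral.integral_const_mul, mul_assoc]
  rw [Finset.sum_congr rfl fun γ hγ => by rw [(htr γ hγ).2]]
  simp only [mul_sub, Finset.sum_sub_distrib, ← Finset.sum_mul]
  ring

variable {κ c a d S w ξ} in
-- Splines of index at least 1 are absolutely continuous, so integration by parts produces no terms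
-- at the knots, and `hbd` removes the terms at a and b.
theorem integral_expSpline_mul_derivOn {m : ℕ} {b : ℝ} {φ : ℝ → ℂ} (hc : c ≠ 0) (hab : a < b)
    (hbd : ∀ n, 1 ≤ n → n < m →
      expSpline κ c a d S w ξ n a = 0 ∧ expSpline κ c a d S w ξ n b = 0)
    (hφ : MemL2m m a b φ) (n : ℕ) (hn : n < m) :
    ∫ x in a..b, expSpline κ c a d S w ξ 0 x * derivOn a b 1 φ x
      = (-1) ^ n * ∫ x in a..b, expSpline κ c a d S w ξ n x * derivOn a b (n + 1) φ x := by
  induction n with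
  | zero => simp
  | succ n ih =>
    rw [ih (by omega), integral_mul_eq_of_absolutelyContinuous
      (absolutelyContinuous_expSpline κ c a d S w ξ n a b)
      ((ae_hasDerivAt_expSpline κ a d S w ξ hc n).mono fun x hx _ => hx)
      (hφ.absolutelyContinuous_derivOn hab hn) (hφ.ae_hasDerivAt_derivOn hab hn),
      (hbd (n + 1) (by omega) hn).1, (hbd (n + 1) (by omega) hn).2, pow_succ]
    ring

end spline

/-! ### Smooth test functions -/

section chain

open Set Filter ComplexConjugate

/-- `F 0` is `m` times continuously differentiable, with derivatives `F 1, …, F m`. -/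
def IsDerivChain (m : ℕ) (F : ℕ → ℝ → ℂ) : Prop :=
  (∀ k < m, ∀ x, HasDerivAt (F k) (F (k + 1) x) x) ∧ Continuous (F m)

variable {m : ℕ} {F G : ℕ → ℝ → ℂ} {a b : ℝ}

theorem IsDerivChain.add (hF : IsDerivChain m F) (hG : IsDerivChain m G) :
    IsDerivChain m (fun k x => F k x + G k x) :=
  ⟨fun k hk x => (hF.1 k hk x).add (hG.1 k hk x), hF.2.add hG.2⟩

theorem IsDerivChain.const_mul (hF : IsDerivChain m F) (t : ℂ) :
    IsDerivChain m (fun k x => t * F k x) :=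
  ⟨fun k hk x => (hF.1 k hk x).const_mul t, continuous_const.mul hF.2⟩

theorem IsDerivChain.conj (hF : IsDerivChain m F) :
    IsDerivChain m (fun k x => conj (F k x)) :=
  ⟨fun k hk x => Complex.conjCLE.toContinuousLinearMap.hasFDerivAt.comp_hasDerivAt x (hF.1 k hk x),
    Complex.continuous_conj.comp hF.2⟩

theorem isDerivChain_polynomial (m : ℕ) (p : Polynomial ℂ) :
    IsDerivChain m (fun k (x : ℝ) => ((Polynomial.derivative^[k] p).eval (x : ℂ))) := by
  refine ⟨fun k _ x => ?_, (Polynomial.continuous _).comp Complex.continuous_ofReal⟩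
  simp only [Function.iterate_succ_apply']
  exact ((Polynomial.derivative^[k] p).hasDerivAt (x : ℂ)).comp_ofReal

theorem IsDerivChain.iteratedDeriv_eq (hF : IsDerivChain m F) {k : ℕ} (hk : k ≤ m) :
    iteratedDeriv k (F 0) = F k := by
  induction k with
  | zero => exact iteratedDeriv_zero
  | succ k ih =>
    rw [iteratedDeriv_succ, ih (by omega)]
    exact funext fun x => (hF.1 k hk x).deriv

theorem IsDerivChain.continuous (hF : IsDerivChain m F) {k : ℕ} (hk : k ≤ m) :
    Continuous (F k) := by
  rcases hk.eq_or_lt with rfl | hk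
  · exact hF.2
  · exact continuous_iff_continuousAt.mpr fun x => (hF.1 k hk x).continuousAt

theorem IsDerivChain.contDiff (hF : IsDerivChain m F) : ContDiff ℝ m (F 0) := by
  rw [contDiff_nat_iff_iteratedDeriv]
  refine ⟨fun k hk => ?_, fun k hk => ?_⟩
  · rw [hF.iteratedDeriv_eq hk]; exact hF.continuous hk
  · rw [hF.iteratedDeriv_eq hk.le]; exact fun x => (hF.1 k hk x).differentiableAt

theorem IsDerivChain.derivOn_eq (hF : IsDerivChain m F) (hab : a < b) {x : ℝ} (hx : x ∈ Icc a b) :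
    derivOn a b m (F 0) x = F m x := by
  rw [derivOn, iteratedDerivWithin_eq_iteratedDeriv (uniqueDiffOn_Icc hab)
    hF.contDiff.contDiffAt hx, hF.iteratedDeriv_eq le_rfl]

theorem IsDerivChain.memL2m (hF : IsDerivChain m F) (hm : 1 ≤ m) (hab : a < b) :
    MemL2m m a b (F 0) := by
  have hd : ContDiffOn ℝ ((m - 1 + 1 : ℕ) : WithTop ℕ∞) (F 0) (Icc a b) := by
    rw [Nat.sub_add_cancel hm]; exact hF.contDiff.contDiffOn
  have h2 := (contDiffOn_nat_succ_iff_contDiffOn_one_iteratedDerivWithin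
    (uniqueDiffOn_Icc hab)).mp hd
  refine ⟨h2.1, ?_, ?_⟩
  · apply ContDiffOn.absolutelyContinuousOnInterval
    rw [uIcc_of_le hab.le]
    exact h2.2
  · obtain ⟨M, hM⟩ := isCompact_Icc.exists_bound_of_continuousOn
      (hF.2.continuousOn (s := Icc a b))
    have hL : MemLp (F m) 2 (volume.restrict (Icc a b)) :=
      MemLp.of_bound hF.2.aestronglyMeasurable M
        ((ae_restrict_iff' measurableSet_Icc).mpr (ae_of_all _ hM))
    refine hL.ae_eq ?_
    rw [EventuallyEq, ae_restrict_iff' measurableSet_Icc]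
    exact ae_of_all _ fun x hx => (hF.derivOn_eq hab hx).symm

theorem IsDerivChain.l2mNorm_eq (hF : IsDerivChain m F) (hab : a < b) :
    l2mNorm m a b (F 0) = Real.sqrt (∫ x in a..b, ‖F m x‖ ^ 2) := by
  rw [l2mNorm]
  congr 1
  refine intervalIntegral.integral_congr fun x hx => ?_
  rw [uIcc_of_le hab.le] at hx
  simp only [hF.derivOn_eq hab hx]

end chain

/-! ### Norm of the error functional and the optimality criterion -/

section optimality

open Set Filter ComplexConjugate

variable {m N : ℕ} {ω a b : ℝ}

theorem quadError_add_const_mul {C : Fin (N + 1) → ℂ} {φ ψ : ℝ → ℂ} (hφ : Continuous φ)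
    (hψ : Continuous ψ) (t : ℂ) :
    quadError ω a b N C (fun x => φ x + t * ψ x)
      = quadError ω a b N C φ + t * quadError ω a b N C ψ := by
  have hexp : Continuous fun x : ℝ => Complex.exp (2 * Real.pi * Complex.I * ω * x) := by fun_prop
  simp only [quadError, mul_add, Finset.sum_add_distrib]
  rw [intervalIntegral.integral_add (Continuous.intervalIntegrable (by fun_prop) _ _)
    (Continuous.intervalIntegrable (by fun_prop) _ _)]
  have h1 : ∀ x : ℝ, Complex.exp (2 * Real.pi * Complex.I * ω * x) * (t * ψ x)
      = t * (Complex.exp (2 * Real.pi * Complex.I * ω * x) * ψ x) := fun x => by ring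
  have h2 : ∀ β : Fin (N + 1), C β * (t * ψ (node a b N β)) = t * (C β * ψ (node a b N β)) :=
    fun β => by ring
  simp_rw [h1, h2, intervalIntegral.integral_const_mul, ← Finset.mul_sum]
  ring

theorem quadError_const_mul {C : Fin (N + 1) → ℂ} {φ : ℝ → ℂ} (hφ : Continuous φ) (t : ℂ) :
    quadError ω a b N C (fun x => t * φ x) = t * quadError ω a b N C φ := by
  have h := quadError_add_const_mul (ω := ω) (a := a) (b := b) (C := C)
    (continuous_const (y := (0 : ℂ))) hφ t
  simpa [quadError] using h

/-- A bound for the norm of the error functional gives a bound for its values. -/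
theorem norm_quadError_le_of_errorNorm_le {C : Fin (N + 1) → ℂ} {F : ℕ → ℝ → ℂ}
    (hF : IsDerivChain m F) (hm : 1 ≤ m) (hab : a < b) {ρ : ℝ} (hρ : 0 ≤ ρ)
    (h : errorNorm m ω a b N C ≤ ENNReal.ofReal ρ) :
    ‖quadError ω a b N C (F 0)‖ ≤ ρ * Real.sqrt (∫ x in a..b, ‖F m x‖ ^ 2) := by
  set n := Real.sqrt (∫ x in a..b, ‖F m x‖ ^ 2) with hn
  have hn0 : 0 ≤ n := Real.sqrt_nonneg _
  -- The seminorm n may be zero, so F is divided by an arbitrary t > n, and t tends to n afterwards.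
  have key : ∀ t, n < t → ‖quadError ω a b N C (F 0)‖ ≤ ρ * t := by
    intro t ht
    have ht0 : 0 < t := hn0.trans_lt ht
    have hG := hF.const_mul ((t⁻¹ : ℝ) : ℂ)
    have hnorm : l2mNorm m a b (fun x => ((t⁻¹ : ℝ) : ℂ) * F 0 x) ≤ 1 := by
      rw [hG.l2mNorm_eq hab]
      have h1 : ∀ x, ‖((t⁻¹ : ℝ) : ℂ) * F m x‖ ^ 2 = (t⁻¹) ^ 2 * ‖F m x‖ ^ 2 := by
        intro x
        rw [norm_mul, Complex.norm_real, Real.norm_of_nonneg (inv_nonneg.mpr ht0.le), mul_pow]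
      simp_rw [h1]
      rw [intervalIntegral.integral_const_mul, Real.sqrt_mul (sq_nonneg _),
        Real.sqrt_sq (inv_nonneg.mpr ht0.le), ← hn, inv_mul_le_one₀ ht0]
      exact ht.le
    have h2 : ‖quadError ω a b N C (fun x => ((t⁻¹ : ℝ) : ℂ) * F 0 x)‖ₑ ≤ ENNReal.ofReal ρ :=
      (le_iSup₂_of_le (hG.memL2m hm hab) hnorm le_rfl : _ ≤ ⨆ (_ : MemL2m m a b
        (fun x => ((t⁻¹ : ℝ) : ℂ) * F 0 x)) (_ : l2mNorm m a b (fun x => ((t⁻¹ : ℝ) : ℂ) * F 0 x)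
          ≤ 1), ‖quadError ω a b N C (fun x => ((t⁻¹ : ℝ) : ℂ) * F 0 x)‖ₑ).trans
        ((le_iSup (fun φ => ⨆ (_ : MemL2m m a b φ) (_ : l2mNorm m a b φ ≤ 1),
          ‖quadError ω a b N C φ‖ₑ) _).trans h)
    rw [quadError_const_mul (hF.continuous (Nat.zero_le m)), ← ofReal_norm,
      ENNReal.ofReal_le_ofReal_iff hρ, norm_mul, Complex.norm_real,
      Real.norm_of_nonneg (inv_nonneg.mpr ht0.le), inv_mul_le_iff₀ ht0] at h2
    linarith
  refine le_of_forall_pos_le_add fun ε hε => ?_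
  have h1 := key (n + ε / (ρ + 1)) (by have : 0 < ε / (ρ + 1) := by positivity
                                       linarith)
  have h2 : ρ * (ε / (ρ + 1)) ≤ ε := by
    rw [mul_div_assoc', div_le_iff₀ (by positivity)]
    nlinarith
  linarith [mul_add ρ n (ε / (ρ + 1))]

/-- The Cauchy-Schwarz inequality on an interval. -/
theorem norm_integral_mul_le {V g : ℝ → ℂ} (hab : a ≤ b)
    (hV : MemLp V 2 (volume.restrict (Icc a b))) (hg : MemLp g 2 (volume.restrict (Icc a b))) :
    ‖∫ x in a..b, V x * g x‖
      ≤ Real.sqrt (∫ x in a..b, ‖V x‖ ^ 2) * Real.sqrt (∫ x in a..b, ‖g x‖ ^ 2) := by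
  have hle : volume.restrict (Ioc a b) ≤ volume.restrict (Icc a b) :=
    Measure.restrict_mono Ioc_subset_Icc_self le_rfl
  have htwo : ENNReal.ofReal 2 = 2 := by simp
  have h := integral_mul_le_Lp_mul_Lq_of_nonneg (μ := volume.restrict (Ioc a b))
    Real.HolderConjugate.two_two (f := fun x => ‖V x‖) (g := fun x => ‖g x‖)
    (ae_of_all _ fun x => norm_nonneg _) (ae_of_all _ fun x => norm_nonneg _)
    (by rw [htwo]; exact (hV.mono_measure hle).norm) (by rw [htwo]; exact (hg.mono_measure hle).norm)
  simp only [Real.rpow_two, ← Real.sqrt_eq_rpow] at h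
  refine (intervalIntegral.norm_integral_le_integral_norm hab).trans ?_
  simp only [intervalIntegral.integral_of_le hab, norm_mul]
  exact h

theorem memLp_two_of_continuous {V : ℝ → ℂ} (hV : Continuous V) :
    MemLp V 2 (volume.restrict (Icc a b)) := by
  obtain ⟨M, hM⟩ := isCompact_Icc.exists_bound_of_continuousOn (hV.continuousOn (s := Icc a b))
  exact MemLp.of_bound hV.aestronglyMeasurable M
    ((ae_restrict_iff' measurableSet_Icc).mpr (ae_of_all _ hM))

theorem mul_conj_eq_norm_sq (z : ℂ) : z * conj z = ((‖z‖ ^ 2 : ℝ) : ℂ) := by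
  rw [Complex.mul_conj, Complex.normSq_eq_norm_sq]

theorem integral_mul_conj {V : ℝ → ℂ} :
    ∫ x in a..b, V x * conj (V x) = ((∫ x in a..b, ‖V x‖ ^ 2 : ℝ) : ℂ) := by
  simp_rw [mul_conj_eq_norm_sq]
  exact intervalIntegral.integral_ofReal

theorem integral_norm_sq_conj_add {V g : ℝ → ℂ} (hV : Continuous V) (hg : Continuous g) (t : ℂ) :
    ∫ x in a..b, ‖conj (V x) + t * g x‖ ^ 2
      = (∫ x in a..b, ‖V x‖ ^ 2) + 2 * (t * ∫ x in a..b, V x * g x).re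
        + ‖t‖ ^ 2 * ∫ x in a..b, ‖g x‖ ^ 2 := by
  have hpt : ∀ x, ‖conj (V x) + t * g x‖ ^ 2
      = ‖V x‖ ^ 2 + 2 * Complex.reCLM (t * (V x * g x)) + ‖t‖ ^ 2 * ‖g x‖ ^ 2 := by
    intro x
    simp only [← Complex.normSq_eq_norm_sq, Complex.normSq_apply, Complex.add_re, Complex.add_im,
      Complex.mul_re, Complex.mul_im, Complex.conj_re, Complex.conj_im, Complex.reCLM_apply]
    ring
  have hc : Continuous fun x => t * (V x * g x) := continuous_const.mul (hV.mul hg)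
  simp_rw [hpt]
  rw [intervalIntegral.integral_add
    (Continuous.intervalIntegrable (by fun_prop) _ _) (Continuous.intervalIntegrable (by fun_prop) _ _),
    intervalIntegral.integral_add
    (Continuous.intervalIntegrable (by fun_prop) _ _) (Continuous.intervalIntegrable (by fun_prop) _ _),
    intervalIntegral.integral_const_mul, intervalIntegral.integral_const_mul,
    ContinuousLinearMap.intervalIntegral_comp_comm _ (hc.intervalIntegrable _ _),
    intervalIntegral.integral_const_mul]
  rfl

/-- Both sides equal p² at t = 0, so their first-order terms must agree. With t = ε conj(z - w)
these differ by 2pε|z - w|², while the quadratic remainder is of order ε². -/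
theorem eq_of_forall_norm_sq_le {p n : ℝ} (hp : 0 < p) {z w : ℂ}
    (h : ∀ t : ℂ, ‖(p : ℂ) + t * z‖ ^ 2 ≤ p * (p + 2 * (t * w).re + ‖t‖ ^ 2 * n)) : z = w := by
  by_contra hne
  have hδ : 0 < ‖z - w‖ ^ 2 := by
    have := norm_pos_iff.mpr (sub_ne_zero.mpr hne)
    positivity
  have key : ∀ ε : ℝ, 0 < ε → 2 ≤ ε * n := by
    intro ε hε
    have h1 := h (ε * conj (z - w))
    have h2 : ‖(p : ℂ) + ε * conj (z - w) * z‖ ^ 2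
        ≥ p ^ 2 + 2 * p * ((ε * conj (z - w)) * z).re := by
      rw [← Complex.normSq_eq_norm_sq, Complex.normSq_apply, Complex.add_re, Complex.add_im,
        Complex.ofReal_re, Complex.ofReal_im]
      nlinarith [sq_nonneg ((ε * conj (z - w)) * z).re, sq_nonneg ((ε * conj (z - w)) * z).im]
    have h3 : ‖(ε : ℂ) * conj (z - w)‖ ^ 2 = ε ^ 2 * ‖z - w‖ ^ 2 := by
      rw [norm_mul, Complex.norm_real, RCLike.norm_conj, mul_pow, Real.norm_eq_abs, sq_abs]
    have h4 : ((ε * conj (z - w)) * z).re - ((ε * conj (z - w)) * w).re = ε * ‖z - w‖ ^ 2 := by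
      rw [← Complex.sub_re, ← mul_sub, mul_assoc, mul_comm (conj (z - w)), mul_conj_eq_norm_sq,
        ← Complex.ofReal_mul, Complex.ofReal_re]
    rw [h3] at h1
    have h5 : 2 * p * (ε * ‖z - w‖ ^ 2) ≤ p * (ε ^ 2 * ‖z - w‖ ^ 2 * n) := by
      rw [← h4]; nlinarith
    have h6 : (p * ε * ‖z - w‖ ^ 2) * 2 ≤ (p * ε * ‖z - w‖ ^ 2) * (ε * n) := by nlinarith
    exact le_of_mul_le_mul_left h6 (by positivity)
  have h1 := key (1 / (|n| + 1)) (by positivity)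
  rw [one_div_mul_eq_div, le_div_iff₀ (by positivity)] at h1
  linarith [le_abs_self n, abs_nonneg n]

theorem node_injective (hab : a < b) (hN : 1 ≤ N) {β γ : ℕ} (h : node a b N β = node a b N γ) :
    β = γ := by
  have hs : step a b N ≠ 0 :=
    div_ne_zero (sub_pos.mpr hab).ne' (by exact_mod_cast (Nat.one_le_iff_ne_zero.mp hN))
  simp only [node, add_left_inj] at h
  exact_mod_cast mul_left_cancel₀ hs h

/-- Optimality from a potential: if the error functional of `C` is represented by the `m`-th
derivative of a function vanishing at the nodes, then `C` is the only optimal choice. -/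
theorem isOptimal_iff_of_representation (hm : 1 ≤ m) (hN : 1 ≤ N) (hab : a < b)
    {C : Fin (N + 1) → ℂ} {F : ℕ → ℝ → ℂ} (hF : IsDerivChain m F)
    (hzero : ∀ β ≤ N, F 0 (node a b N β) = 0)
    (hrep : ∀ φ, MemL2m m a b φ →
      quadError ω a b N C φ = (-1) ^ m * ∫ x in a..b, F m x * derivOn a b m φ x)
    (C' : Fin (N + 1) → ℂ) : IsOptimal m ω a b N C' ↔ C' = C := by
  set p := ∫ x in a..b, ‖F m x‖ ^ 2 with hp
  have hp0 : 0 ≤ p := intervalIntegral.integral_nonneg hab.le fun x _ => by positivity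
  set ρ := Real.sqrt p with hρ
  have hρ0 : 0 ≤ ρ := Real.sqrt_nonneg _
  have hρp : ρ * ρ = p := Real.mul_self_sqrt hp0
  have hrep' : ∀ G, IsDerivChain m G →
      quadError ω a b N C (G 0) = (-1) ^ m * ∫ x in a..b, F m x * G m x := by
    intro G hG
    rw [hrep _ (hG.memL2m hm hab)]
    congr 1
    refine intervalIntegral.integral_congr fun x hx => ?_
    rw [uIcc_of_le hab.le] at hx
    simp only [hG.derivOn_eq hab hx]
  have hsign : ‖((-1 : ℂ)) ^ m‖ = 1 := by simp
  have hupper : errorNorm m ω a b N C ≤ ENNReal.ofReal ρ := by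
    refine iSup_le fun φ => iSup_le fun hφ => iSup_le fun h1 => ?_
    rw [← ofReal_norm, ENNReal.ofReal_le_ofReal_iff hρ0, hrep φ hφ, norm_mul, hsign, one_mul]
    refine (norm_integral_mul_le hab.le (memLp_two_of_continuous hF.2)
      hφ.square_integrable).trans ?_
    exact (mul_le_mul_of_nonneg_left h1 hρ0).trans_eq (mul_one ρ)
  -- Since conj F_0 vanishes at the nodes, its quadrature error is the same for all coefficients and
  -- can be computed with C.
  have hconj : ∀ C'' : Fin (N + 1) → ℂ,
      quadError ω a b N C'' (fun x => conj (F 0 x)) = (-1) ^ m * p := by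
    intro C''
    rw [hp, ← integral_mul_conj, ← hrep' _ hF.conj]
    have hz : ∀ β : Fin (N + 1), conj (F 0 (node a b N β)) = 0 := fun β => by
      rw [hzero β (Nat.lt_succ_iff.mp β.2), map_zero]
    simp only [quadError, hz, mul_zero, Finset.sum_const_zero]
  have hlower : ∀ C'' : Fin (N + 1) → ℂ, ENNReal.ofReal ρ ≤ errorNorm m ω a b N C'' := by
    intro C''
    by_cases htop : errorNorm m ω a b N C'' = ⊤
    · rw [htop]; exact le_top
    rw [← ENNReal.ofReal_toReal htop]
    apply ENNReal.ofReal_le_ofReal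
    set ρ' := (errorNorm m ω a b N C'').toReal with hρ'
    have hρ'0 : 0 ≤ ρ' := ENNReal.toReal_nonneg
    have h1 := norm_quadError_le_of_errorNorm_le hF.conj hm hab hρ'0 (C := C'')
      (ENNReal.ofReal_toReal htop).ge
    simp only [RCLike.norm_conj] at h1
    rw [hconj, norm_mul, hsign, one_mul, Complex.norm_real, Real.norm_of_nonneg hp0, ← hp, ← hρ,
      ← hρp] at h1
    rcases hρ0.eq_or_lt with h0 | h0
    · rw [← h0]; exact hρ'0
    · exact le_of_mul_le_mul_right h1 h0
  have hinf : ⨅ C'' : Fin (N + 1) → ℂ, errorNorm m ω a b N C'' = ENNReal.ofReal ρ :=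
    le_antisymm ((iInf_le _ C).trans hupper) (le_iInf hlower)
  constructor
  · rintro ⟨-, hopt⟩
    rw [hinf] at hopt
    -- The norm bound for C' applied to conj F_0 + tG is an equality at t = 0, so the first-order
    -- terms in t determine the value at G.
    have hval : ∀ G, IsDerivChain m G →
        quadError ω a b N C' (G 0) = quadError ω a b N C (G 0) := by
      intro G hG
      have hvar : ∀ t : ℂ, ‖(p : ℂ) + t * ((-1) ^ m * quadError ω a b N C' (G 0))‖ ^ 2
          ≤ p * (p + 2 * (t * ((-1) ^ m * quadError ω a b N C (G 0))).re
            + ‖t‖ ^ 2 * ∫ x in a..b, ‖G m x‖ ^ 2) := by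
        intro t
        have h1 := norm_quadError_le_of_errorNorm_le (hF.conj.add (hG.const_mul t)) hm hab hρ0
          hopt.le
        have hss : ((-1 : ℂ) ^ m) * (-1) ^ m = 1 := by rw [← mul_pow]; simp
        rw [quadError_add_const_mul (hF.conj.continuous (Nat.zero_le m))
          (hG.continuous (Nat.zero_le m)), hconj, integral_norm_sq_conj_add hF.2 hG.2] at h1
        rw [show (p : ℂ) + t * ((-1) ^ m * quadError ω a b N C' (G 0))
            = (-1) ^ m * ((-1) ^ m * p + t * quadError ω a b N C' (G 0)) by
          linear_combination (-(p : ℂ)) * hss, norm_mul, hsign, one_mul, hrep' G hG]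
        rw [← mul_assoc ((-1 : ℂ) ^ m) ((-1) ^ m), hss, one_mul]
        have hnn : 0 ≤ p + 2 * (t * ∫ x in a..b, F m x * G m x).re
            + ‖t‖ ^ 2 * ∫ x in a..b, ‖G m x‖ ^ 2 := by
          rw [hp, ← integral_norm_sq_conj_add hF.2 hG.2]
          exact intervalIntegral.integral_nonneg hab.le fun x _ => by positivity
        refine (pow_le_pow_left₀ (norm_nonneg _) h1 2).trans_eq ?_
        rw [mul_pow, Real.sq_sqrt hnn, hρ, Real.sq_sqrt hp0]
      -- If p = 0 the variational argument degenerates, but then both functionals vanish at G: the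
      -- one of C' by the bound at t = 1, the one of C by Cauchy-Schwarz.
      rcases hp0.eq_or_lt with h0 | h0
      · have h1 := hvar 1
        rw [← h0] at h1
        have h2 := pow_eq_zero_iff (two_ne_zero) |>.mp
          (le_antisymm (h1.trans_eq (zero_mul _)) (sq_nonneg _))
        have h3 : quadError ω a b N C' (G 0) = 0 := by simpa using h2
        have h4 := norm_integral_mul_le hab.le (memLp_two_of_continuous (a := a) (b := b) hF.2)
          (memLp_two_of_continuous hG.2)
        rw [← hp, ← h0, Real.sqrt_zero, zero_mul] at h4
        rw [h3, hrep' G hG, norm_le_zero_iff.mp h4, mul_zero]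
      · have h1 := eq_of_forall_norm_sq_le h0 hvar
        exact mul_left_cancel₀ (pow_ne_zero m (neg_ne_zero.mpr one_ne_zero)) h1
    funext β
    -- P vanishes at all nodes except the one with index β. The integrals in the two errors cancel,
    -- leaving C' β and C β multiplied by the same nonzero value.
    let P : Polynomial ℂ := ∏ γ ∈ Finset.univ.erase β,
      (Polynomial.X - Polynomial.C ((node a b N γ : ℝ) : ℂ))
    have hP0 : ∀ γ : Fin (N + 1), γ ≠ β → P.eval ((node a b N γ : ℝ) : ℂ) = 0 := by
      intro γ hγ
      rw [Polynomial.eval_prod]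
      exact Finset.prod_eq_zero (Finset.mem_erase.mpr ⟨hγ, Finset.mem_univ _⟩) (by simp)
    have hP1 : P.eval ((node a b N β : ℝ) : ℂ) ≠ 0 := by
      rw [Polynomial.eval_prod]
      refine Finset.prod_ne_zero_iff.mpr fun γ hγ => ?_
      simp only [Polynomial.eval_sub, Polynomial.eval_X, Polynomial.eval_C]
      refine sub_ne_zero.mpr fun h => (Finset.mem_erase.mp hγ).1 ?_
      exact Fin.ext (node_injective hab hN (by exact_mod_cast h.symm))
    have h1 := hval _ (isDerivChain_polynomial m P)
    simp only [Function.iterate_zero, id_eq, quadError, sub_right_inj] at h1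
    rw [Finset.sum_eq_single β (fun γ _ hγ => by rw [hP0 γ hγ, mul_zero]) (by simp),
      Finset.sum_eq_single β (fun γ _ hγ => by rw [hP0 γ hγ, mul_zero]) (by simp)] at h1
    exact mul_right_cancel₀ hP1 h1
  · rintro rfl
    refine ⟨fun α hα => ?_, by rw [hinf]; exact le_antisymm hupper (hlower C')⟩
    have h1 := hrep' _ (isDerivChain_polynomial m (Polynomial.X ^ α))
    have h2 : Polynomial.derivative^[m] (Polynomial.X ^ α : Polynomial ℂ) = 0 :=
      Polynomial.iterate_derivative_eq_zero (by rw [Polynomial.natDegree_X_pow]; exact hα)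
    simp only [h2, Polynomial.eval_zero, mul_zero, intervalIntegral.integral_zero] at h1
    simpa using h1

end optimality

/-! ### Splines built from the roots of the Euler-Frobenius polynomial -/

section eulerSpline

open Set Filter ComplexConjugate

variable {ι : Type*} [Fintype ι]

/-- `∑_i α_i r_i^β G_n(r_i / (r_i - 1))`. -/
def moment (r α : ι → ℂ) (β n : ℕ) : ℂ :=
  ∑ i, α i * (r i ^ β * (momentPoly ℂ n).eval (r i / (r i - 1)))

/-- The Taylor coefficients at `a` of the spline `eulerSpline`. -/
def eulerCoeff (κ c : ℂ) (a h : ℝ) (m : ℕ) (r α : ι → ℂ) (n : ℕ) : ℂ :=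
  (h : ℂ) ^ (n + 1) / (n.factorial : ℂ) * moment r α 0 n
    + if n = 2 * m - 1 then κ * Complex.exp (c * a) / c ^ (n + 1) else 0

/-- The jumps of the spline `eulerSpline`. -/
def eulerWeight (h : ℝ) (r α : ι → ℂ) (γ : ℕ) : ℂ := h * ∑ i, α i * r i ^ γ

/-- The spline `κ e^{cx}/c^{n+1} - h^{n+1} S_n((x-a)/h)`, where `S_n` is a combination of the
exponential Euler splines with the multipliers `r_i`. -/
def eulerSpline (κ c : ℂ) (a b : ℝ) (m N : ℕ) (r α : ι → ℂ) : ℕ → ℝ → ℂ :=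
  expSpline κ c a (eulerCoeff κ c a (step a b N) m r α) (Finset.Ico 1 N)
    (eulerWeight (step a b N) r α) (node a b N)

variable {κ c : ℂ} {a b : ℝ} {m N : ℕ} {r α : ι → ℂ}

theorem step_pos (hab : a < b) (hN : 1 ≤ N) : 0 < step a b N :=
  div_pos (sub_pos.mpr hab) (by exact_mod_cast hN)

theorem node_zero : node a b N 0 = a := by simp [node]

theorem node_self (hN : 1 ≤ N) : node a b N N = b := by
  have : (N : ℝ) ≠ 0 := by exact_mod_cast Nat.one_le_iff_ne_zero.mp hN
  rw [node, step, div_mul_cancel₀ _ this]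
  ring

theorem node_mem_Icc (hab : a < b) (hN : 1 ≤ N) {β : ℕ} (hβ : β ≤ N) :
    a ≤ node a b N β ∧ node a b N β ≤ b := by
  have h := step_pos hab hN
  have h1 : (0 : ℝ) ≤ β := Nat.cast_nonneg β
  have h2 : (β : ℝ) ≤ N := by exact_mod_cast hβ
  constructor
  · rw [node]; nlinarith
  · conv_rhs => rw [← node_self (a := a) (b := b) hN]
    rw [node, node]; nlinarith

/-- The Taylor coefficients at a are scaled values G_i(s), so the polynomial piece of the spline is
a combination of Appell polynomials in (x-a)/h. -/
theorem sum_taylor_eq_appell (h : ℂ) (s : ι → ℂ) (n : ℕ) (β : ℂ) :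
    ∑ i ∈ Finset.range (n + 1), h ^ (i + 1) / (i.factorial : ℂ)
        * (∑ j, α j * (momentPoly ℂ i).eval (s j)) * ((h * β) ^ (n - i) / ((n - i).factorial : ℂ))
      = h ^ (n + 1) / (n.factorial : ℂ) * ∑ j, α j * (appell (s j) n).eval β := by
  have h1 : ∀ j, (appell (s j) n).eval β = ∑ i ∈ Finset.range (n + 1),
      (n.choose i : ℂ) * (momentPoly ℂ i).eval (s j) * β ^ (n - i) := by
    intro j
    simp [appell, Polynomial.eval_finsetSum]
  simp_rw [h1, Finset.mul_sum, Finset.sum_mul]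
  rw [Finset.sum_comm]
  refine Finset.sum_congr rfl fun j _ => Finset.sum_congr rfl fun i hi => ?_
  have hi' : i ≤ n := Nat.lt_succ_iff.mp (Finset.mem_range.mp hi)
  have h2 : (n.choose i : ℂ) * (i.factorial : ℂ) * ((n - i).factorial : ℂ) = n.factorial := by
    exact_mod_cast Nat.choose_mul_factorial_mul_factorial hi'
  have h3 : h ^ (n + 1) = h ^ (i + 1) * h ^ (n - i) := by
    rw [← pow_add]; congr 1; omega
  have f1 : (i.factorial : ℂ) ≠ 0 := by exact_mod_cast Nat.factorial_ne_zero i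
  have f2 : ((n - i).factorial : ℂ) ≠ 0 := by exact_mod_cast Nat.factorial_ne_zero (n - i)
  have f3 : (n.factorial : ℂ) ≠ 0 := by exact_mod_cast Nat.factorial_ne_zero n
  rw [h3, mul_pow]
  field_simp
  linear_combination
    (-(h ^ (i + 1) * h ^ (n - i) * α j * Polynomial.eval (s j) (momentPoly ℂ i) * β ^ (n - i))) * h2

theorem sum_eulerWeight_mul_truncPow {h : ℝ} (hh : 0 < h) {n : ℕ} (hn : n ≠ 0) {β : ℕ}
    (hβ : β ≤ N) :
    ∑ γ ∈ Finset.Ico 1 N, eulerWeight h r α γ * truncPow n ((h * β + a) - (h * γ + a))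
      = (h : ℂ) ^ (n + 1) / (n.factorial : ℂ)
        * ∑ j, α j * ∑ γ ∈ Finset.range β, r j ^ (γ + 1) * ((β : ℂ) - (γ + 1 : ℕ)) ^ n := by
  have h1 : ∀ γ ∈ Finset.Ico 1 N,
      eulerWeight h r α γ * truncPow n ((h * β + a) - (h * γ + a))
      = if γ < β then (h : ℂ) ^ (n + 1) / (n.factorial : ℂ)
        * ∑ j, α j * (r j ^ γ * ((β : ℂ) - γ) ^ n) else 0 := by
    intro γ _
    have h2 : (h * β + a) - (h * γ + a) = h * ((β : ℝ) - γ) := by ring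
    rw [h2, truncPow]
    by_cases hγ : γ < β
    · have h3 : (0 : ℝ) < (β : ℝ) - γ := sub_pos.mpr (by exact_mod_cast hγ)
      rw [if_pos (mul_pos hh h3), if_pos hγ, eulerWeight, Finset.mul_sum, Finset.mul_sum,
        Finset.sum_mul]
      refine Finset.sum_congr rfl fun j _ => ?_
      push_cast
      rw [mul_pow]
      ring
    · have h3 : (β : ℝ) - γ ≤ 0 := sub_nonpos.mpr (by exact_mod_cast not_lt.mp hγ)
      rw [if_neg (not_lt.mpr (mul_nonpos_of_nonneg_of_nonpos hh.le h3)), if_neg hγ, mul_zero]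
  rw [Finset.sum_congr rfl h1, ← Finset.sum_filter]
  have h4 : (Finset.Ico 1 N).filter (fun γ => γ < β) = Finset.Ico 1 β := by
    ext γ
    simp only [Finset.mem_filter, Finset.mem_Ico]
    omega
  rw [h4]
  -- The extra term γ + 1 = β is 0^n, which vanishes because n ≠ 0.
  have h5 : ∀ j, ∑ γ ∈ Finset.range β, r j ^ (γ + 1) * ((β : ℂ) - (γ + 1 : ℕ)) ^ n
      = ∑ γ ∈ Finset.Ico 1 β, r j ^ γ * ((β : ℂ) - γ) ^ n := by
    intro j
    rw [Finset.range_eq_Ico, Finset.sum_Ico_add' (fun γ : ℕ => r j ^ γ * ((β : ℂ) - γ) ^ n) 0 β 1]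
    rcases β with _ | β
    · simp
    · rw [zero_add, Finset.sum_Ico_succ_top (by omega)]
      simp [zero_pow hn]
  simp_rw [h5]
  rw [← Finset.mul_sum, Finset.sum_comm]
  simp_rw [Finset.mul_sum]

/-- The truncated powers cancel the correction sum in `appell_eval_natCast`, so only r^β G_n(s)
survives. The last term comes from the integration constant in `eulerCoeff`, which enters only at
the top index 2m-1. -/
theorem eulerSpline_node (hab : a < b) (hN : 1 ≤ N) (hr : ∀ i, r i ≠ 1) {n : ℕ} (hn : n ≠ 0)
    (hnm : n ≤ 2 * m - 1) {β : ℕ} (hβ : β ≤ N) :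
    eulerSpline κ c a b m N r α n (node a b N β)
      = κ * Complex.exp (c * node a b N β) / c ^ (n + 1)
        - (step a b N : ℂ) ^ (n + 1) / (n.factorial : ℂ) * moment r α β n
        - if n = 2 * m - 1 then κ * Complex.exp (c * a) / c ^ (n + 1) else 0 := by
  have hh := step_pos hab hN
  set h := step a b N with hhd
  have hx : ((node a b N β - a : ℝ) : ℂ) = h * (β : ℂ) := by
    rw [node, ← hhd]; push_cast; ring
  rw [eulerSpline, expSpline, hx, ← hhd]
  have hw := sum_eulerWeight_mul_truncPow (r := r) (α := α) (a := a) hh hn hβ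
  simp only [node, ← hhd] at hw ⊢
  rw [hw]
  have hd : ∑ i ∈ Finset.range (n + 1), eulerCoeff κ c a h m r α i
        * (((h : ℂ) * β) ^ (n - i) / ((n - i).factorial : ℂ))
      = (h : ℂ) ^ (n + 1) / (n.factorial : ℂ)
          * ∑ j, α j * (appell (r j / (r j - 1)) n).eval (β : ℂ)
        + if n = 2 * m - 1 then κ * Complex.exp (c * a) / c ^ (n + 1) else 0 := by
    rw [← sum_taylor_eq_appell]
    simp only [eulerCoeff, moment, pow_zero, one_mul, add_mul, Finset.sum_add_distrib]
    congr 1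
    rw [Finset.sum_range_succ, Finset.sum_eq_zero]
    · simp
    · intro i hi
      have := Finset.mem_range.mp hi
      rw [if_neg (by omega), zero_mul]
  rw [hd]
  have ha : ∀ j, α j * (appell (r j / (r j - 1)) n).eval (β : ℂ)
      = α j * (r j ^ β * (momentPoly ℂ n).eval (r j / (r j - 1)))
        - α j * ∑ γ ∈ Finset.range β, r j ^ (γ + 1) * ((β : ℂ) - (γ + 1 : ℕ)) ^ n := by
    intro j
    rw [appell_eval_natCast (hr j), mul_sub]
  simp_rw [ha, Finset.sum_sub_distrib]
  rw [moment]
  ring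

/-- The weight at the left endpoint. -/
def leftWeight (κ c : ℂ) (a h : ℝ) (r α : ι → ℂ) : ℂ :=
  h * ∑ i, α i * (r i / (r i - 1)) - κ * Complex.exp (c * a) / c

/-- The weight at the right endpoint. -/
def rightWeight (κ c : ℂ) (a h : ℝ) (N : ℕ) (r α : ι → ℂ) : ℂ :=
  h * ∑ i, α i * (r i ^ N * (1 - r i / (r i - 1))) + κ * Complex.exp (c * a) / c

/-- The right-hand sides prescribed for the moments are, after scaling by h^{n+1}/n!, the end values
of the exponential part. -/
theorem eulerSpline_boundary (hab : a < b) (hN : 1 ≤ N) (hc : c ≠ 0) (hr : ∀ i, r i ≠ 1)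
    (hexp : Complex.exp (c * b) = Complex.exp (c * a))
    (h0 : ∀ j, 1 ≤ j → j < m → moment r α 0 j
      = κ * ((j.factorial : ℂ) * Complex.exp (c * a) / (c * step a b N) ^ (j + 1)))
    (h1 : ∀ j, 1 ≤ j → j < m → moment r α N j
      = κ * ((j.factorial : ℂ) * Complex.exp (c * a) / (c * step a b N) ^ (j + 1)))
    {n : ℕ} (hn : 1 ≤ n) (hnm : n < m) :
    eulerSpline κ c a b m N r α n a = 0 ∧ eulerSpline κ c a b m N r α n b = 0 := by
  have hs : ((step a b N : ℝ) : ℂ) ≠ 0 := by exact_mod_cast (step_pos hab hN).ne'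
  have hf : (n.factorial : ℂ) ≠ 0 := by exact_mod_cast Nat.factorial_ne_zero n
  have e0 := eulerSpline_node (κ := κ) (c := c) (α := α) (m := m) hab hN hr (by omega : n ≠ 0)
    (by omega) (Nat.zero_le N)
  have e1 := eulerSpline_node (κ := κ) (c := c) (α := α) (m := m) hab hN hr (by omega : n ≠ 0)
    (by omega) (le_refl N)
  rw [if_neg (by omega)] at e0 e1
  rw [node_zero, h0 n hn hnm] at e0
  rw [node_self hN, h1 n hn hnm, hexp] at e1
  constructor
  · rw [e0, mul_pow]; field_simp; ring
  · rw [e1, mul_pow]; field_simp; ring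

/-- The quadrature error with the weights of the spline, as an integral against the spline. -/
theorem eulerSpline_representation (hm : 1 ≤ m) (hab : a < b) (hN : 1 ≤ N) (hc : c ≠ 0)
    (hr : ∀ i, r i ≠ 1)
    (hexp : Complex.exp (c * b) = Complex.exp (c * a))
    (h0 : ∀ j, 1 ≤ j → j < m → moment r α 0 j
      = κ * ((j.factorial : ℂ) * Complex.exp (c * a) / (c * step a b N) ^ (j + 1)))
    (h1 : ∀ j, 1 ≤ j → j < m → moment r α N j
      = κ * ((j.factorial : ℂ) * Complex.exp (c * a) / (c * step a b N) ^ (j + 1)))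
    {φ : ℝ → ℂ} (hφ : MemL2m m a b φ) :
    κ * (∫ x in a..b, Complex.exp (c * x) * φ x)
        - (leftWeight κ c a (step a b N) r α * φ a
          + ∑ γ ∈ Finset.Ico 1 N, eulerWeight (step a b N) r α γ * φ (node a b N γ)
          + rightWeight κ c a (step a b N) N r α * φ b)
      = (-1) ^ m * ∫ x in a..b, eulerSpline κ c a b m N r α (m - 1) x * derivOn a b m φ x := by
  have hA := integral_expSpline_mul_derivOn
    (d := eulerCoeff κ c a (step a b N) m r α) (S := Finset.Ico 1 N)
    (w := eulerWeight (step a b N) r α) (ξ := node a b N) (κ := κ) hc hab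
    (fun n hn hnm => eulerSpline_boundary hab hN hc hr hexp h0 h1 hn hnm) hφ (m - 1) (by omega)
  have hac := hφ.absolutelyContinuous_derivOn hab (i := 0) hm
  have hd := hφ.ae_hasDerivAt_derivOn hab (i := 0) hm
  rw [derivOn_zero] at hac hd
  have hB := integral_expSpline_zero_mul
    (d := eulerCoeff κ c a (step a b N) m r α) (S := Finset.Ico 1 N)
    (w := eulerWeight (step a b N) r α) (ξ := node a b N) (κ := κ) hc
    (fun γ hγ => node_mem_Icc hab hN (Finset.mem_Ico.mp hγ).2.le) hac hd
  have hm1 : m - 1 + 1 = m := Nat.sub_add_cancel hm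
  rw [hm1] at hA
  have hpow : (-1 : ℂ) ^ m = -(-1) ^ (m - 1) := by
    conv_lhs => rw [← hm1, pow_succ]
    ring
  have hcoef : eulerCoeff κ c a (step a b N) m r α 0
      = step a b N * ∑ i, α i * (r i / (r i - 1)) := by
    rw [eulerCoeff, if_neg (by omega)]
    simp [moment, momentPoly_zero]
  -- A geometric sum, read off from the case n = 0 of `appell_eval_natCast`, where H_0 is the
  -- constant s.
  have hsum : ∑ γ ∈ Finset.Ico 1 N, eulerWeight (step a b N) r α γ
      = step a b N * ∑ i, α i * (r i ^ N * (r i / (r i - 1)) - r i / (r i - 1) - r i ^ N) := by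
    simp only [eulerWeight]
    rw [← Finset.mul_sum, Finset.sum_comm]
    congr 1
    refine Finset.sum_congr rfl fun i _ => ?_
    rw [← Finset.mul_sum]
    congr 1
    have happ := appell_eval_natCast (hr i) 0 N
    simp only [appell, zero_add, Finset.range_one, Finset.sum_singleton, Nat.choose_self,
      Nat.cast_one, one_mul, momentPoly_zero, Polynomial.eval_X, Nat.sub_self, pow_zero, mul_one,
      Polynomial.eval_C] at happ
    rw [Finset.range_eq_Ico, Finset.sum_Ico_add' (fun γ : ℕ => r i ^ γ) 0 N 1, zero_add,
      Finset.sum_Ico_succ_top hN] at happ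
    linear_combination happ
  rw [eulerSpline, hpow, neg_mul, ← hA, hB, hcoef, hsum, hexp, leftWeight, rightWeight]
  simp only [mul_sub, Finset.sum_sub_distrib, mul_one]
  ring

/-- The m-th derivative has index m-1. It is continuous for m ≥ 2; for m = 1 it has index 0, but
there are no multipliers and hence no jumps. -/
theorem eulerSpline_isDerivChain (hm : 1 ≤ m) (hc : c ≠ 0) (hι : m = 1 → IsEmpty ι) :
    IsDerivChain m (fun k => eulerSpline κ c a b m N r α (2 * m - 1 - k)) := by
  have hcase : ∀ n, m ≤ n + 1 → (n ≠ 0 ∨ ∀ γ ∈ Finset.Ico 1 N, eulerWeight (step a b N) r α γ = 0)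
      := by
    intro n hn
    by_cases h : n = 0
    · have := hι (by omega)
      exact Or.inr fun γ _ => by simp [eulerWeight]
    · exact Or.inl h
  refine ⟨fun k hk x => ?_, ?_⟩
  · have h := hasDerivAt_expSpline κ a (eulerCoeff κ c a (step a b N) m r α) (Finset.Ico 1 N)
      (eulerWeight (step a b N) r α) (node a b N) hc (2 * m - 1 - (k + 1)) x
      ((hcase _ (by omega)).imp_right Or.inl)
    rw [show 2 * m - 1 - (k + 1) + 1 = 2 * m - 1 - k by omega] at h
    exact h
  · exact continuous_expSpline κ c a _ _ _ _ _ (hcase _ (by omega))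

/-- The root condition annihilates the Euler part, and periodicity on the grid makes the exponential
part cancel the integration constant. -/
theorem eulerSpline_node_eq_zero (hm : 1 ≤ m) (hab : a < b) (hN : 1 ≤ N) (hr : ∀ i, r i ≠ 1)
    (hroot : ∀ i, (momentPoly ℂ (2 * m - 1)).eval (r i / (r i - 1)) = 0) {β : ℕ} (hβ : β ≤ N)
    (hexp : Complex.exp (c * node a b N β) = Complex.exp (c * a)) :
    eulerSpline κ c a b m N r α (2 * m - 1) (node a b N β) = 0 := by
  rw [eulerSpline_node hab hN hr (by omega) le_rfl hβ, if_pos rfl, hexp]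
  simp [moment, hroot]

/-- A spline without exponential part, vanishing at the nodes and with zero boundary conditions,
is zero. -/
theorem eq_zero_of_moment_eq_zero (hm : 2 ≤ m) (hab : a < b) (hN : 1 ≤ N) (hNm : m ≤ N + 1)
    (hr : ∀ i, r i ≠ 1) (hr0 : ∀ i, r i ≠ 0) (hinj : Function.Injective r)
    (hcard : Fintype.card ι ≤ 2 * m - 2)
    (hroot : ∀ i, (momentPoly ℂ (2 * m - 1)).eval (r i / (r i - 1)) = 0)
    (hc : c ≠ 0) (hexp : ∀ β ≤ N, Complex.exp (c * node a b N β) = Complex.exp (c * a))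
    (h0 : ∀ j, 1 ≤ j → j < m → moment r α 0 j = 0)
    (h1 : ∀ j, 1 ≤ j → j < m → moment r α N j = 0) : α = 0 := by
  have hm1 : 1 ≤ m := by omega
  have hh := step_pos hab hN
  have hhC : ((step a b N : ℝ) : ℂ) ≠ 0 := by exact_mod_cast hh.ne'
  have hι : m = 1 → IsEmpty ι := fun h => by omega
  have hF := eulerSpline_isDerivChain (κ := 0) (a := a) (b := b) (N := N) (r := r) (α := α) hm1 hc hι
  set F : ℕ → ℝ → ℂ := fun k => eulerSpline 0 c a b m N r α (2 * m - 1 - k) with hFdef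
  have hF0 : ∀ β ≤ N, F 0 (node a b N β) = 0 := fun β hβ =>
    eulerSpline_node_eq_zero hm1 hab hN hr hroot hβ (hexp β hβ)
  -- The representation is tested on conj F_0: with κ = 0 and F_0 zero at the nodes its left side
  -- vanishes, leaving ∫ |F_m|² = 0 with F_m continuous.
  have hFm : ∀ x ∈ Icc a b, F m x = 0 := by
    have hrep := eulerSpline_representation (κ := 0) (α := α) hm1 hab hN hc hr
      (by have := hexp N le_rfl; rwa [node_self hN] at this)
      (fun j hj hjm => by rw [h0 j hj hjm, zero_mul])
      (fun j hj hjm => by rw [h1 j hj hjm, zero_mul]) (hF.conj.memL2m hm1 hab)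
    have hza := hF0 0 (Nat.zero_le N)
    have hzb := hF0 N le_rfl
    rw [node_zero] at hza
    rw [node_self hN] at hzb
    have hzs : ∑ γ ∈ Finset.Ico 1 N, eulerWeight (step a b N) r α γ
        * conj (F 0 (node a b N γ)) = 0 :=
      Finset.sum_eq_zero fun γ hγ => by
        rw [hF0 γ (Finset.mem_Ico.mp hγ).2.le, map_zero, mul_zero]
    simp only [hzs, hza, hzb, map_zero, mul_zero, zero_mul, add_zero, sub_zero] at hrep
    have hint : ∫ x in a..b, F m x * conj (F m x) = 0 := by
      have h2 : ∫ x in a..b, eulerSpline 0 c a b m N r α (m - 1) x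
          * derivOn a b m (fun x => conj (F 0 x)) x = ∫ x in a..b, F m x * conj (F m x) := by
        refine intervalIntegral.integral_congr fun x hx => ?_
        rw [uIcc_of_le hab.le] at hx
        simp only [hF.conj.derivOn_eq hab hx]
        rw [hFdef]
        simp only [show 2 * m - 1 - m = m - 1 by omega]
      rw [← h2]
      exact (mul_eq_zero.mp hrep.symm).resolve_left (pow_ne_zero m (neg_ne_zero.mpr one_ne_zero))
    rw [integral_mul_conj, Complex.ofReal_eq_zero] at hint
    intro x hx
    by_contra hne
    have hpos := intervalIntegral.integral_pos hab
      ((hF.2.norm.pow 2).continuousOn (s := Icc a b)) (fun y _ => sq_nonneg _)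
      ⟨x, hx, pow_pos (norm_pos_iff.mpr hne) 2⟩
    exact hpos.ne' hint
  -- With zero remainder F_0 equals its Taylor polynomial of degree below m. Its zeros at the first
  -- m nodes, available since m ≤ N + 1, kill the coefficients through a Vandermonde matrix.
  have hcoef : ∀ k < m, F k a = 0 := by
    have htaylor : ∀ x ∈ Icc a b,
        ∑ k ∈ Finset.range m, F k a / (k.factorial : ℂ) * ((x - a : ℝ) : ℂ) ^ k = F 0 x := by
      intro x hx
      have hcd : ContDiffOn ℝ ((m - 1 : ℕ) + 1) (F 0) (Icc a b) := by
        have := hF.contDiff.contDiffOn (s := Icc a b)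
        rwa [show (m : WithTop ℕ∞) = ((m - 1 : ℕ) + 1) by
          exact_mod_cast (Nat.sub_add_cancel hm1).symm] at this
      have h2 := taylor_mean_remainder_bound hab.le hcd hx (C := 0) (fun y hy => by
        rw [Nat.sub_add_cancel hm1, iteratedDerivWithin_eq_iteratedDeriv (uniqueDiffOn_Icc hab)
          hF.contDiff.contDiffAt hy, hF.iteratedDeriv_eq le_rfl, hFm y hy, norm_zero])
      rw [zero_mul, zero_div] at h2
      rw [sub_eq_zero.mp (norm_le_zero_iff.mp h2), taylor_within_apply, Nat.sub_add_cancel hm1]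
      refine Finset.sum_congr rfl fun k hk => ?_
      have hk' := Finset.mem_range.mp hk
      rw [iteratedDerivWithin_eq_iteratedDeriv (uniqueDiffOn_Icc hab)
        (hF.contDiff.of_le (by exact_mod_cast hk'.le)).contDiffAt (left_mem_Icc.mpr hab.le),
        hF.iteratedDeriv_eq hk'.le, Complex.real_smul]
      push_cast
      ring
    have hv : (fun k : Fin m => F k a / ((k : ℕ).factorial : ℂ)) = 0 := by
      refine Matrix.eq_zero_of_forall_index_sum_mul_pow_eq_zero
        (f := fun j : Fin m => ((node a b N j - a : ℝ) : ℂ)) ?_ ?_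
      · intro i j hij
        exact Fin.ext (node_injective hab hN (sub_left_injective (Complex.ofReal_injective hij)))
      · intro j
        have hj : (j : ℕ) ≤ N := by have := j.2; omega
        rw [Fin.sum_univ_eq_sum_range (fun k => F k a / (k.factorial : ℂ)
          * ((node a b N j - a : ℝ) : ℂ) ^ k) m, htaylor _ (node_mem_Icc hab hN hj), hF0 j hj]
    intro k hk
    have h3 := congrFun hv ⟨k, hk⟩
    exact (div_eq_zero_iff.mp h3).resolve_right (by exact_mod_cast Nat.factorial_ne_zero k)
  have hval : ∀ n, n ≠ 0 → n ≤ 2 * m - 1 → ∀ β ≤ N,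
      eulerSpline 0 c a b m N r α n (node a b N β)
        = -((step a b N : ℂ) ^ (n + 1) / (n.factorial : ℂ) * moment r α β n) := by
    intro n hn hnm β hβ
    rw [eulerSpline_node hab hN hr hn hnm hβ]
    simp
  have hne : ∀ n : ℕ, (step a b N : ℂ) ^ (n + 1) / (n.factorial : ℂ) ≠ 0 := fun n =>
    div_ne_zero (pow_ne_zero _ hhC) (by exact_mod_cast Nat.factorial_ne_zero n)
  -- Indices below m are covered by the boundary conditions at a, the others by the vanishing
  -- derivatives of order 2m-1-n < m.
  have hmom : ∀ n, n ≠ 0 → n ≤ 2 * m - 1 → moment r α 0 n = 0 := by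
    intro n hn hnm
    rcases lt_or_ge n m with hlt | hge
    · exact h0 n (Nat.one_le_iff_ne_zero.mpr hn) hlt
    · have h2 := hcoef (2 * m - 1 - n) (by omega)
      rw [hFdef] at h2
      simp only [show 2 * m - 1 - (2 * m - 1 - n) = n by omega] at h2
      have h3 := hval n hn hnm 0 (Nat.zero_le N)
      rw [node_zero, h2] at h3
      exact (mul_eq_zero.mp (neg_eq_zero.mp h3.symm)).resolve_left (hne n)
  -- At the node x_1 no truncated power is active yet, and the other Taylor coefficients are zero,
  -- so F_m(x_1) = 0 isolates the coefficient of (x-a)^{m-1}.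
  have hmom0 : moment r α 0 0 = 0 := by
    have h2 : eulerSpline 0 c a b m N r α (m - 1) (node a b N 1) = 0 := by
      have h3 := hFm _ (node_mem_Icc hab hN hN)
      rw [hFdef] at h3
      simpa only [show 2 * m - 1 - m = m - 1 by omega] using h3
    have hw := sum_eulerWeight_mul_truncPow (r := r) (α := α) (a := a) hh
      (by omega : m - 1 ≠ 0) hN
    have hx : ((node a b N 1 - a : ℝ) : ℂ) = step a b N := by rw [node]; push_cast; ring
    rw [eulerSpline, expSpline, hx] at h2
    simp only [node] at h2
    rw [hw] at h2
    have hz : ∀ i ∈ Finset.range (m - 1 + 1), i ≠ 0 →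
        eulerCoeff 0 c a (step a b N) m r α i * ((step a b N : ℂ) ^ (m - 1 - i)
          / ((m - 1 - i).factorial : ℂ)) = 0 := by
      intro i hi hi0
      have := Finset.mem_range.mp hi
      rw [eulerCoeff, hmom i hi0 (by omega)]
      simp
    rw [Finset.sum_eq_single 0 hz (by simp)] at h2
    have hlast : ∑ j, α j * ∑ γ ∈ Finset.range 1,
        r j ^ (γ + 1) * (((1 : ℕ) : ℂ) - ((γ + 1 : ℕ) : ℂ)) ^ (m - 1) = 0 := by
      refine Finset.sum_eq_zero fun j _ => ?_
      simp [show m - 1 ≠ 0 by omega]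
    rw [hlast] at h2
    simp only [zero_mul, zero_div, mul_zero, sub_zero, zero_sub, neg_eq_zero, Nat.sub_zero] at h2
    have h4 := (mul_eq_zero.mp h2).resolve_right
      (div_ne_zero (pow_ne_zero _ hhC) (by exact_mod_cast Nat.factorial_ne_zero _))
    rw [eulerCoeff, if_neg (by omega), add_zero] at h4
    exact (mul_eq_zero.mp h4).resolve_left (hne 0)
  refine eq_zero_of_sum_momentPoly_eq_zero (s := fun i => r i / (r i - 1)) ?_ ?_ ?_
  · intro i j hij
    refine hinj ?_
    rw [← div_sub_one_involutive (hr i), ← div_sub_one_involutive (hr j)]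
    simp only at hij
    rw [hij]
  · exact fun i => div_ne_zero (hr0 i) (sub_ne_zero.mpr (hr i))
  · intro n hn
    have h2 : moment r α 0 n = 0 := by
      rcases eq_or_ne n 0 with rfl | hn0
      · exact hmom0
      · exact hmom n hn0 (by omega)
    simpa [moment] using h2

end eulerSpline

/-! ### The linear system -/

section system

variable {m N : ℕ} {ω a b : ℝ} {q : Fin (m - 1) → ℂ}

/-- With s = z/(z-1), the basis element X(X-1)^t takes the value z/(z-1)^{t+1} at s, and
z^t/(1-z)^{t+1} at 1-s; the latter is used in the companion lemma. -/
theorem sum_diffZero_div_sub_one {z : ℂ} (hz : z ≠ 1) {j : ℕ} (hj : j ≠ 0) (K : ℕ) :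
    ∑ t ∈ Finset.Icc 1 j, z ^ (K + 1) * diffZero t j / (z - 1) ^ (t + 1)
      = z ^ K * (momentPoly ℂ j).eval (z / (z - 1)) := by
  have h1 : z - 1 ≠ 0 := sub_ne_zero.mpr hz
  have h2 : z / (z - 1) - 1 = 1 / (z - 1) := by field_simp; ring
  rw [momentPoly_eval_eq_sum_diffZero j hj, h2, Finset.mul_sum]
  refine Finset.sum_congr rfl fun t _ => ?_
  rw [div_pow, one_pow]
  field_simp
  ring

theorem sum_diffZero_div_one_sub {z : ℂ} (hz : z ≠ 1) {j : ℕ} (hj : j ≠ 0) (K : ℕ) :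
    ∑ t ∈ Finset.Icc 1 j, z ^ (K + t) * diffZero t j / (1 - z) ^ (t + 1)
      = z ^ K * (momentPoly ℂ j).eval (1 - z / (z - 1)) := by
  have h1 : z - 1 ≠ 0 := sub_ne_zero.mpr hz
  have h1' : 1 - z ≠ 0 := sub_ne_zero.mpr hz.symm
  have h2 : 1 - z / (z - 1) = 1 / (1 - z) := by field_simp; ring
  have h3 : 1 / (1 - z) - 1 = z / (1 - z) := by field_simp; ring
  rw [momentPoly_eval_eq_sum_diffZero j hj, h2, h3, Finset.mul_sum]
  refine Finset.sum_congr rfl fun t _ => ?_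
  rw [div_pow]
  field_simp
  ring

/-- The boundary functional at the left endpoint. -/
def leftMoment (N : ℕ) (q A B : Fin (m - 1) → ℂ) (j : ℕ) : ℂ :=
  ∑ k, A k * (momentPoly ℂ j).eval (q k / (q k - 1))
    + ∑ k, B k * (q k ^ N * (momentPoly ℂ j).eval (1 - q k / (q k - 1)))

/-- The boundary functional at the right endpoint. -/
def rightMoment (N : ℕ) (q A B : Fin (m - 1) → ℂ) (j : ℕ) : ℂ :=
  ∑ k, A k * (q k ^ N * (momentPoly ℂ j).eval (q k / (q k - 1)))
    + ∑ k, B k * (momentPoly ℂ j).eval (1 - q k / (q k - 1))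

/-- The second block of the system contains the boundary functionals with s and 1-s exchanged; the
reflection of G_j turns them back at the cost of a sign. -/
theorem leftMoment_symm (A B : Fin (m - 1) → ℂ) {j : ℕ} (hj : j ≠ 0) :
    ∑ k, A k * (momentPoly ℂ j).eval (1 - q k / (q k - 1))
      + ∑ k, B k * (q k ^ N * (momentPoly ℂ j).eval (q k / (q k - 1)))
      = (-1) ^ (j + 1) * leftMoment N q A B j := by
  obtain ⟨j, rfl⟩ := Nat.exists_eq_succ_of_ne_zero hj
  have h : ((-1 : ℂ)) ^ j * (-1) ^ j = 1 := by rw [← mul_pow]; simp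
  simp only [leftMoment, Nat.succ_eq_add_one, momentPoly_eval_one_sub, mul_add, Finset.mul_sum]
  congr 1
  · exact Finset.sum_congr rfl fun k _ => by ring
  · refine Finset.sum_congr rfl fun k _ => ?_
    linear_combination
      (-(B k * q k ^ N * (momentPoly ℂ (j + 1)).eval (q k / (q k - 1)))) * h

theorem rightMoment_symm (A B : Fin (m - 1) → ℂ) {j : ℕ} (hj : j ≠ 0) :
    ∑ k, A k * (q k ^ N * (momentPoly ℂ j).eval (1 - q k / (q k - 1)))
      + ∑ k, B k * (momentPoly ℂ j).eval (q k / (q k - 1))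
      = (-1) ^ (j + 1) * rightMoment N q A B j := by
  obtain ⟨j, rfl⟩ := Nat.exists_eq_succ_of_ne_zero hj
  have h : ((-1 : ℂ)) ^ j * (-1) ^ j = 1 := by rw [← mul_pow]; simp
  simp only [rightMoment, Nat.succ_eq_add_one, momentPoly_eval_one_sub, mul_add, Finset.mul_sum]
  congr 1
  · exact Finset.sum_congr rfl fun k _ => by ring
  · refine Finset.sum_congr rfl fun k _ => ?_
    linear_combination
      (-(B k * (momentPoly ℂ (j + 1)).eval (q k / (q k - 1)))) * h

/-- A triangular homogeneous system with unit diagonal has only the trivial solution. -/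
theorem forall_eq_zero_of_triangular {M : ℕ} {ρ : ℕ → ℕ → ℂ} {u : ℕ → ℂ} (hρ : ∀ j, ρ j j = 1)
    (h : ∀ j ∈ Finset.Icc 1 M, ∑ i ∈ Finset.Icc 1 j, ρ j i * u i = 0) :
    ∀ j ∈ Finset.Icc 1 M, u j = 0 := by
  intro j
  induction j using Nat.strong_induction_on with
  | _ j ih =>
    intro hj
    have h1 := h j hj
    rw [Finset.sum_eq_single j, hρ, one_mul] at h1
    · exact h1
    · intro i hi hij
      have h2 := Finset.mem_Icc.mp hi
      have h3 := Finset.mem_Icc.mp hj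
      rw [ih i (by omega) (Finset.mem_Icc.mpr ⟨h2.1, by omega⟩), mul_zero]
    · intro hj'
      exact absurd (Finset.mem_Icc.mpr ⟨(Finset.mem_Icc.mp hj).1, le_rfl⟩) hj'

/-- The first block is the left boundary condition. The second is, up to sign, the left condition of
index j minus a combination of right conditions of indices i ≤ j. The coefficient at i = j is 1, so
the right conditions can be recovered recursively. Equality of the exponentials at a and b makes the
two right-hand sides coincide. -/
theorem isSolution_iff (hq : ∀ k, q k ≠ 1) (hexp : expo ω b = expo ω a) (A B : Fin (m - 1) → ℂ) :
    IsSolution m ω a b N q A B ↔ ∀ j ∈ Finset.Icc 1 (m - 1),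
      leftMoment N q A B j = (j.factorial : ℂ) * expo ω a / freq ω (step a b N) ^ (j + 1) ∧
      rightMoment N q A B j = (j.factorial : ℂ) * expo ω a / freq ω (step a b N) ^ (j + 1) := by
  set f := freq ω (step a b N) with hf
  set R : ℕ → ℂ := fun j => (j.factorial : ℂ) * expo ω a / f ^ (j + 1) with hR
  set ρ : ℕ → ℕ → ℂ := fun j i =>
    ((step a b N / (b - a) : ℝ) : ℂ) ^ ((i : ℤ) - (j : ℤ)) * (j.choose i : ℂ) with hρ
  have hρ1 : ∀ j, ρ j j = 1 := fun j => by simp [hρ]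
  have hfirst : ∀ j ∈ Finset.Icc 1 (m - 1),
      ∑ k, A k * (∑ t ∈ Finset.Icc 1 j, q k * diffZero t j / (q k - 1) ^ (t + 1))
        + ∑ k, B k * (∑ t ∈ Finset.Icc 1 j, q k ^ (N + t) * diffZero t j / (1 - q k) ^ (t + 1))
      = leftMoment N q A B j := by
    intro j hj
    have hj0 : j ≠ 0 := by have := Finset.mem_Icc.mp hj; omega
    rw [leftMoment]
    congr 1
    · refine Finset.sum_congr rfl fun k _ => ?_
      have := sum_diffZero_div_sub_one (hq k) hj0 0
      simp only [zero_add, pow_one, pow_zero, one_mul] at this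
      rw [this]
    · refine Finset.sum_congr rfl fun k _ => ?_
      rw [sum_diffZero_div_one_sub (hq k) hj0]
  have hsecond : ∀ j ∈ Finset.Icc 1 (m - 1),
      ∑ k, A k * ((∑ t ∈ Finset.Icc 1 j, q k ^ t * diffZero t j / (1 - q k) ^ (t + 1))
        - ∑ α ∈ Finset.Icc 1 j, ((step a b N / (b - a) : ℝ) : ℂ) ^ ((α : ℤ) - (j : ℤ))
          * (j.choose α : ℂ)
          * ∑ t ∈ Finset.Icc 1 α, q k ^ (N + t) * diffZero t α / (1 - q k) ^ (t + 1))
      + ∑ k, B k * ((∑ t ∈ Finset.Icc 1 j, q k ^ (N + 1) * diffZero t j / (q k - 1) ^ (t + 1))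
        - ∑ α ∈ Finset.Icc 1 j, ((step a b N / (b - a) : ℝ) : ℂ) ^ ((α : ℤ) - (j : ℤ))
          * (j.choose α : ℂ)
          * ∑ t ∈ Finset.Icc 1 α, q k * diffZero t α / (q k - 1) ^ (t + 1))
      = (-1) ^ (j + 1) * leftMoment N q A B j
        - ∑ i ∈ Finset.Icc 1 j, ρ j i * ((-1) ^ (i + 1) * rightMoment N q A B i) := by
    intro j hj
    have hj0 : j ≠ 0 := by have := Finset.mem_Icc.mp hj; omega
    have e1 : ∀ k, ∑ t ∈ Finset.Icc 1 j, q k ^ t * diffZero t j / (1 - q k) ^ (t + 1)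
        = (momentPoly ℂ j).eval (1 - q k / (q k - 1)) := by
      intro k
      have := sum_diffZero_div_one_sub (hq k) hj0 0
      simpa only [zero_add, pow_zero, one_mul] using this
    have e2 : ∀ k, ∑ i ∈ Finset.Icc 1 j,
        ((step a b N / (b - a) : ℝ) : ℂ) ^ ((i : ℤ) - (j : ℤ)) * (j.choose i : ℂ)
          * ∑ t ∈ Finset.Icc 1 i, q k ^ (N + t) * diffZero t i / (1 - q k) ^ (t + 1)
        = ∑ i ∈ Finset.Icc 1 j,
          ρ j i * (q k ^ N * (momentPoly ℂ i).eval (1 - q k / (q k - 1))) := by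
      refine fun k => Finset.sum_congr rfl fun i hi => ?_
      have hi0 : i ≠ 0 := by have := Finset.mem_Icc.mp hi; omega
      rw [sum_diffZero_div_one_sub (hq k) hi0]
    have e3 : ∀ k, ∑ i ∈ Finset.Icc 1 j,
        ((step a b N / (b - a) : ℝ) : ℂ) ^ ((i : ℤ) - (j : ℤ)) * (j.choose i : ℂ)
          * ∑ t ∈ Finset.Icc 1 i, q k * diffZero t i / (q k - 1) ^ (t + 1)
        = ∑ i ∈ Finset.Icc 1 j, ρ j i * (momentPoly ℂ i).eval (q k / (q k - 1)) := by
      refine fun k => Finset.sum_congr rfl fun i hi => ?_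
      have hi0 : i ≠ 0 := by have := Finset.mem_Icc.mp hi; omega
      have := sum_diffZero_div_sub_one (hq k) hi0 0
      simp only [zero_add, pow_one, pow_zero, one_mul] at this
      rw [this]
    have e4 : ∀ i ∈ Finset.Icc 1 j, ρ j i * ((-1) ^ (i + 1) * rightMoment N q A B i)
        = ∑ k, A k * (ρ j i * (q k ^ N * (momentPoly ℂ i).eval (1 - q k / (q k - 1))))
          + ∑ k, B k * (ρ j i * (momentPoly ℂ i).eval (q k / (q k - 1))) := by
      intro i hi
      have hi0 : i ≠ 0 := by have := Finset.mem_Icc.mp hi; omega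
      rw [← rightMoment_symm A B hi0, mul_add, Finset.mul_sum, Finset.mul_sum]
      congr 1 <;> exact Finset.sum_congr rfl fun k _ => by ring
    simp_rw [e1, e2, e3, sum_diffZero_div_sub_one (hq _) hj0 N]
    rw [Finset.sum_congr rfl e4, ← leftMoment_symm A B hj0]
    simp only [mul_sub, Finset.sum_sub_distrib, Finset.sum_add_distrib, Finset.mul_sum]
    rw [Finset.sum_comm (s := Finset.Icc 1 j), Finset.sum_comm (s := Finset.Icc 1 j)]
    ring
  have hrhs : ∀ j ∈ Finset.Icc 1 (m - 1),
      (-1 : ℂ) ^ (j + 1) * (j.factorial : ℂ) * expo ω a / f ^ (j + 1)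
        + ∑ α ∈ Finset.Icc 1 j, ((step a b N / (b - a) : ℝ) : ℂ) ^ ((α : ℤ) - (j : ℤ))
          * ((-1 : ℂ) ^ α * (j.factorial : ℂ) * expo ω b
            / (((j - α).factorial : ℂ) * f ^ (α + 1)))
      = (-1) ^ (j + 1) * R j - ∑ i ∈ Finset.Icc 1 j, ρ j i * ((-1) ^ (i + 1) * R i) := by
    intro j _
    rw [sub_eq_add_neg ((-1) ^ (j + 1) * R j), ← Finset.sum_neg_distrib]
    congr 1
    · rw [hR]; ring
    · refine Finset.sum_congr rfl fun i hi => ?_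
      have hf2 : ((j - i).factorial : ℂ) ≠ 0 := by exact_mod_cast Nat.factorial_ne_zero _
      have hch : (j.factorial : ℂ) / ((j - i).factorial : ℂ) = j.choose i * i.factorial := by
        rw [div_eq_iff hf2]
        exact_mod_cast (Nat.choose_mul_factorial_mul_factorial (Finset.mem_Icc.mp hi).2).symm
      rw [hexp, hρ, hR, mul_div_mul_comm ((-1 : ℂ) ^ i * (j.factorial : ℂ)), mul_div_assoc, hch]
      ring
  have hmain : IsSolution m ω a b N q A B ↔
      (∀ j ∈ Finset.Icc 1 (m - 1), leftMoment N q A B j = R j) ∧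
      (∀ j ∈ Finset.Icc 1 (m - 1), (-1) ^ (j + 1) * leftMoment N q A B j
        - ∑ i ∈ Finset.Icc 1 j, ρ j i * ((-1) ^ (i + 1) * rightMoment N q A B i)
        = (-1) ^ (j + 1) * R j - ∑ i ∈ Finset.Icc 1 j, ρ j i * ((-1) ^ (i + 1) * R i)) := by
    unfold IsSolution
    refine and_congr (forall₂_congr fun j hj => ?_) (forall₂_congr fun j hj => ?_)
    · rw [hfirst j hj]
    · rw [hsecond j hj, hrhs j hj]
  rw [hmain]
  constructor
  · rintro ⟨h1, h2⟩ j hj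
    refine ⟨h1 j hj, ?_⟩
    have h3 := forall_eq_zero_of_triangular (M := m - 1) (ρ := ρ)
      (u := fun i => (-1) ^ (i + 1) * rightMoment N q A B i - (-1) ^ (i + 1) * R i) hρ1
      (fun i hi => by
        have h4 := h2 i hi
        rw [h1 i hi, sub_right_inj] at h4
        simp only [mul_sub, Finset.sum_sub_distrib]
        rw [h4, sub_self]) j hj
    exact mul_left_cancel₀ (pow_ne_zero (j + 1) (neg_ne_zero.mpr one_ne_zero)) (sub_eq_zero.mp h3)
  · intro h
    refine ⟨fun j hj => (h j hj).1, fun j hj => ?_⟩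
    rw [(h j hj).1]
    congr 1
    refine Finset.sum_congr rfl fun i hi => ?_
    rw [(h i (Finset.mem_Icc.mpr ⟨(Finset.mem_Icc.mp hi).1,
      (Finset.mem_Icc.mp hi).2.trans (Finset.mem_Icc.mp hj).2⟩)).2]

/-! ### The multipliers and the amplitudes of the spline -/

/-- The multipliers `q_k` and `1 / q_k`. -/
def multipliers (q : Fin (m - 1) → ℂ) : Fin (m - 1) ⊕ Fin (m - 1) → ℂ :=
  Sum.elim q fun k => (q k)⁻¹

/-- The amplitudes `a_k` and `b_k q_k^N`. -/
def amplitudes (N : ℕ) (q A B : Fin (m - 1) → ℂ) : Fin (m - 1) ⊕ Fin (m - 1) → ℂ :=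
  Sum.elim A fun k => B k * q k ^ N

theorem IsRootList.ne (hq : IsRootList m q) (k : Fin (m - 1)) :
    q k ≠ 0 ∧ q k ≠ 1 ∧ (momentPoly ℂ (2 * m - 1)).eval (q k / (q k - 1)) = 0 := by
  have h := (eulerFrobenius_isRoot_iff _ _).mp ((hq.2 (q k)).mpr ⟨k, rfl⟩).1
  have hk := k.2
  rwa [show 2 * m - 2 + 1 = 2 * m - 1 by omega] at h

theorem IsRootList.multipliers_ne_one (hq : IsRootList m q) (i) : multipliers q i ≠ 1 := by
  rcases i with k | k
  · exact (hq.ne k).2.1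
  · simpa [multipliers] using (hq.ne k).2.1

theorem IsRootList.multipliers_ne_zero (hq : IsRootList m q) (i) : multipliers q i ≠ 0 := by
  rcases i with k | k
  · exact (hq.ne k).1
  · exact inv_ne_zero (hq.ne k).1

theorem IsRootList.multipliers_root (hq : IsRootList m q) (i) :
    (momentPoly ℂ (2 * m - 1)).eval (multipliers q i / (multipliers q i - 1)) = 0 := by
  rcases i with k | k
  · exact (hq.ne k).2.2
  · obtain ⟨h0, h1, h2⟩ := hq.ne k
    have hk := k.2
    obtain ⟨n, hn⟩ := Nat.exists_eq_succ_of_ne_zero (show 2 * m - 1 ≠ 0 by omega)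
    simp only [multipliers, Sum.elim_inr]
    rw [inv_div_inv_sub_one h0 h1]
    rw [hn] at h2 ⊢
    rw [Nat.succ_eq_add_one, momentPoly_eval_one_sub, h2, mul_zero]

/-- The q_k lie inside the unit circle and their reciprocals outside. -/
theorem IsRootList.multipliers_injective (hq : IsRootList m q) :
    Function.Injective (multipliers q) := by
  have hlt : ∀ k, ‖q k‖ < 1 := fun k => ((hq.2 (q k)).mpr ⟨k, rfl⟩).2
  have hgt : ∀ k, 1 < ‖(q k)⁻¹‖ := fun k => by
    rw [norm_inv]
    exact (one_lt_inv₀ (norm_pos_iff.mpr (hq.ne k).1)).mpr (hlt k)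
  refine hq.1.sumElim (fun i j hij => hq.1 (inv_injective hij)) fun i j hij => ?_
  have h1 := hlt i
  rw [hij] at h1
  exact lt_asymm h1 (hgt j)

theorem IsRootList.moment_zero (hq : IsRootList m q) (A B : Fin (m - 1) → ℂ) (j : ℕ) :
    moment (multipliers q) (amplitudes N q A B) 0 j = leftMoment N q A B j := by
  simp only [moment, Fintype.sum_sum_type, multipliers, amplitudes, Sum.elim_inl, Sum.elim_inr,
    pow_zero, one_mul, leftMoment]
  congr 1
  refine Finset.sum_congr rfl fun k _ => ?_
  rw [inv_div_inv_sub_one (hq.ne k).1 (hq.ne k).2.1, mul_assoc]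

theorem IsRootList.moment_right (hq : IsRootList m q) (A B : Fin (m - 1) → ℂ) (j : ℕ) :
    moment (multipliers q) (amplitudes N q A B) N j = rightMoment N q A B j := by
  simp only [moment, Fintype.sum_sum_type, multipliers, amplitudes, Sum.elim_inl, Sum.elim_inr,
    rightMoment]
  congr 1
  refine Finset.sum_congr rfl fun k _ => ?_
  have h := pow_ne_zero N (hq.ne k).1
  rw [inv_div_inv_sub_one (hq.ne k).1 (hq.ne k).2.1, inv_pow, mul_assoc, mul_inv_cancel_left₀ h]

theorem exp_node (hωh : ∃ n : ℤ, ω * step a b N = n) (β : ℕ) :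
    Complex.exp (2 * Real.pi * Complex.I * ω * node a b N β)
      = Complex.exp (2 * Real.pi * Complex.I * ω * a) := by
  obtain ⟨n, hn⟩ := hωh
  have hn' : (ω : ℂ) * (step a b N : ℂ) = n := by exact_mod_cast hn
  rw [Complex.exp_eq_exp_iff_exists_int]
  refine ⟨n * β, ?_⟩
  rw [node]
  push_cast
  linear_combination (2 * Real.pi * Complex.I * β) * hn'

/-- The homogeneous system has only the trivial solution. -/
theorem IsRootList.eq_zero_of_moments (hq : IsRootList m q) (hab : a < b) (hN : 1 ≤ N)
    (hNm : m ≤ N + 1) (hω : ω ≠ 0) (hωh : ∃ n : ℤ, ω * step a b N = n) {A B : Fin (m - 1) → ℂ}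
    (h : ∀ j, 1 ≤ j → j < m → leftMoment N q A B j = 0 ∧ rightMoment N q A B j = 0) :
    A = 0 ∧ B = 0 := by
  rcases lt_or_ge m 2 with hm | hm
  · have hem : ∀ k : Fin (m - 1), False := fun k => by have := k.2; omega
    exact ⟨funext fun k => (hem k).elim, funext fun k => (hem k).elim⟩
  have hc : (2 * Real.pi * Complex.I * ω : ℂ) ≠ 0 := by
    simp [Complex.I_ne_zero, Real.pi_ne_zero, hω]
  have h1 := eq_zero_of_moment_eq_zero (α := amplitudes N q A B) hm hab hN hNm
    hq.multipliers_ne_one hq.multipliers_ne_zero hq.multipliers_injective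
    (by simp; omega) hq.multipliers_root hc (fun β _ => exp_node hωh β)
    (fun j hj hjm => by rw [hq.moment_zero]; exact (h j hj hjm).1)
    (fun j hj hjm => by rw [hq.moment_right]; exact (h j hj hjm).2)
  refine ⟨funext fun k => congrFun h1 (Sum.inl k), funext fun k => ?_⟩
  exact (mul_eq_zero.mp (congrFun h1 (Sum.inr k))).resolve_right (pow_ne_zero N (hq.ne k).1)

/-- The boundary functionals as a linear map. -/
def momentMap (N : ℕ) (q : Fin (m - 1) → ℂ) :
    ((Fin (m - 1) → ℂ) × (Fin (m - 1) → ℂ)) →ₗ[ℂ] (Fin (m - 1) → ℂ) × (Fin (m - 1) → ℂ) where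
  toFun p := (fun j => leftMoment N q p.1 p.2 (j + 1), fun j => rightMoment N q p.1 p.2 (j + 1))
  map_add' p p' := by
    ext j <;> simp only [leftMoment, rightMoment, Prod.fst_add, Prod.snd_add, Pi.add_apply,
      add_mul, Finset.sum_add_distrib] <;> ring
  map_smul' t p := by
    ext j <;> simp only [leftMoment, rightMoment, Prod.smul_fst, Prod.smul_snd, Pi.smul_apply,
      smul_eq_mul, mul_assoc, ← Finset.mul_sum, RingHom.id_apply, mul_add]

theorem IsRootList.momentMap_injective (hq : IsRootList m q) (hab : a < b) (hN : 1 ≤ N)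
    (hNm : m ≤ N + 1) (hω : ω ≠ 0) (hωh : ∃ n : ℤ, ω * step a b N = n) :
    Function.Injective (momentMap N q) := by
  rw [← LinearMap.ker_eq_bot, LinearMap.ker_eq_bot']
  rintro ⟨A, B⟩ h
  have h1 := congrArg Prod.fst h
  have h2 := congrArg Prod.snd h
  obtain ⟨hA, hB⟩ := hq.eq_zero_of_moments (A := A) (B := B) hab hN hNm hω hωh fun j hj hjm => by
    have e1 := congrFun h1 ⟨j - 1, by omega⟩
    have e2 := congrFun h2 ⟨j - 1, by omega⟩
    simp only [momentMap, LinearMap.coe_mk, AddHom.coe_mk, Nat.sub_add_cancel hj] at e1 e2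
    exact ⟨e1, e2⟩
  rw [hA, hB]
  rfl

/-- `momentMap` is an injective endomorphism of a finite-dimensional space, hence bijective. -/
theorem IsRootList.existsUnique_isSolution (hq : IsRootList m q) (hab : a < b) (hN : 1 ≤ N)
    (hNm : m ≤ N + 1) (hω : ω ≠ 0) (hωh : ∃ n : ℤ, ω * step a b N = n) :
    ∃ A B : Fin (m - 1) → ℂ, IsSolution m ω a b N q A B ∧
      ∀ A' B' : Fin (m - 1) → ℂ, IsSolution m ω a b N q A' B' → A' = A ∧ B' = B := by
  have hexp : expo ω b = expo ω a := by
    have := exp_node hωh N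
    rwa [node_self hN] at this
  have hinj := hq.momentMap_injective hab hN hNm hω hωh
  set R : Fin (m - 1) → ℂ := fun j => (((j : ℕ) + 1).factorial : ℂ) * expo ω a
    / freq ω (step a b N) ^ ((j : ℕ) + 1 + 1) with hR
  have hiff : ∀ A B, IsSolution m ω a b N q A B ↔ momentMap N q (A, B) = (R, R) := by
    intro A B
    rw [isSolution_iff (fun k => (hq.ne k).2.1) hexp]
    constructor
    · intro h
      have hj : ∀ j : Fin (m - 1), (j : ℕ) + 1 ∈ Finset.Icc 1 (m - 1) := fun j =>
        Finset.mem_Icc.mpr ⟨by omega, j.2⟩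
      exact Prod.ext (funext fun j => (h _ (hj j)).1) (funext fun j => (h _ (hj j)).2)
    · intro h j hj
      obtain ⟨hj1, hj2⟩ := Finset.mem_Icc.mp hj
      have e1 := congrFun (congrArg Prod.fst h) ⟨j - 1, by omega⟩
      have e2 := congrFun (congrArg Prod.snd h) ⟨j - 1, by omega⟩
      simp only [momentMap, LinearMap.coe_mk, AddHom.coe_mk, Nat.sub_add_cancel hj1, hR] at e1 e2
      exact ⟨e1, e2⟩
  obtain ⟨⟨A, B⟩, hAB⟩ := (LinearMap.injective_iff_surjective.mp hinj) (R, R)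
  refine ⟨A, B, (hiff A B).mpr hAB, fun A' B' h => ?_⟩
  have := hinj (((hiff A' B').mp h).trans hAB.symm)
  exact ⟨congrArg Prod.fst this, congrArg Prod.snd this⟩

/-! ### The optimal coefficients -/

/-- The optimal coefficients. -/
def optimalCoeff (ω a b : ℝ) (N : ℕ) (q A B : Fin (m - 1) → ℂ) (β : Fin (N + 1)) : ℂ :=
  if (β : ℕ) = 0 then
    (step a b N : ℂ) * (-(expo ω a / freq ω (step a b N))
      + ∑ k, (A k * (q k / (q k - 1)) + B k * (q k ^ N / (1 - q k))))
  else if (β : ℕ) = N then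
    (step a b N : ℂ) * (expo ω b / freq ω (step a b N)
      + ∑ k, (A k * (q k ^ N / (1 - q k)) + B k * (q k / (q k - 1))))
  else (step a b N : ℂ) * ∑ k, (A k * q k ^ (β : ℕ) + B k * q k ^ (N - (β : ℕ)))

/-- Identifies the stated coefficients with the weights of the spline. Since b_k q_k^{N-γ} = (b_k
q_k^N)(1/q_k)^γ, the b-terms belong to the multipliers 1/q_k, for which s is replaced by 1-s. -/
theorem sum_optimalCoeff_mul (hq : IsRootList m q) (hab : a < b) (hN : 1 ≤ N) (hω : ω ≠ 0)
    (hexp : expo ω b = expo ω a) (A B : Fin (m - 1) → ℂ) (u : ℕ → ℂ) :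
    ∑ β : Fin (N + 1), optimalCoeff ω a b N q A B β * u β
      = leftWeight 1 (2 * Real.pi * Complex.I * ω) a (step a b N) (multipliers q)
          (amplitudes N q A B) * u 0
        + ∑ γ ∈ Finset.Ico 1 N,
          eulerWeight (step a b N) (multipliers q) (amplitudes N q A B) γ * u γ
        + rightWeight 1 (2 * Real.pi * Complex.I * ω) a (step a b N) N (multipliers q)
          (amplitudes N q A B) * u N := by
  have hs : ((step a b N : ℝ) : ℂ) ≠ 0 := by exact_mod_cast (step_pos hab hN).ne'
  have hc : (2 * Real.pi * Complex.I * ω : ℂ) ≠ 0 := by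
    simp [Complex.I_ne_zero, Real.pi_ne_zero, hω]
  have hfreq : (step a b N : ℂ) * (expo ω a / freq ω (step a b N))
      = Complex.exp (2 * Real.pi * Complex.I * ω * a) / (2 * Real.pi * Complex.I * ω) := by
    rw [expo, freq]
    field_simp
  have hleft : optimalCoeff ω a b N q A B 0
      = leftWeight 1 (2 * Real.pi * Complex.I * ω) a (step a b N) (multipliers q)
          (amplitudes N q A B) := by
    rw [optimalCoeff, if_pos (by simp), leftWeight, one_mul, ← hfreq, mul_add, mul_neg,
      neg_add_eq_sub]
    congr 2
    rw [Fintype.sum_sum_type, Finset.sum_add_distrib]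
    simp only [multipliers, amplitudes, Sum.elim_inl, Sum.elim_inr]
    congr 1
    refine Finset.sum_congr rfl fun k _ => ?_
    have h1 : q k - 1 ≠ 0 := sub_ne_zero.mpr (hq.ne k).2.1
    have h2 : 1 - q k ≠ 0 := sub_ne_zero.mpr (hq.ne k).2.1.symm
    rw [inv_div_inv_sub_one (hq.ne k).1 (hq.ne k).2.1]
    field_simp
    ring
  have hright : optimalCoeff ω a b N q A B (Fin.last N)
      = rightWeight 1 (2 * Real.pi * Complex.I * ω) a (step a b N) N (multipliers q)
          (amplitudes N q A B) := by
    rw [optimalCoeff, Fin.val_last, if_neg (by omega), if_pos rfl, rightWeight, one_mul, hexp,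
      ← hfreq, mul_add, add_comm]
    congr 2
    rw [Fintype.sum_sum_type, Finset.sum_add_distrib]
    simp only [multipliers, amplitudes, Sum.elim_inl, Sum.elim_inr]
    congr 1
    · refine Finset.sum_congr rfl fun k _ => ?_
      have h1 : q k - 1 ≠ 0 := sub_ne_zero.mpr (hq.ne k).2.1
      have h2 : 1 - q k ≠ 0 := sub_ne_zero.mpr (hq.ne k).2.1.symm
      field_simp
      ring
    · refine Finset.sum_congr rfl fun k _ => ?_
      have h3 := pow_ne_zero N (hq.ne k).1
      rw [inv_div_inv_sub_one (hq.ne k).1 (hq.ne k).2.1, inv_pow, mul_assoc,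
        mul_inv_cancel_left₀ h3, sub_sub_cancel]
  have hmid : ∀ γ : ℕ, 1 ≤ γ → (hγ : γ < N) →
      optimalCoeff ω a b N q A B ⟨γ, by omega⟩
        = eulerWeight (step a b N) (multipliers q) (amplitudes N q A B) γ := by
    intro γ hγ1 hγ
    simp only [optimalCoeff]
    rw [if_neg (by omega), if_neg (by omega), eulerWeight, Fintype.sum_sum_type,
      Finset.sum_add_distrib]
    simp only [multipliers, amplitudes, Sum.elim_inl, Sum.elim_inr]
    congr 2
    refine Finset.sum_congr rfl fun k _ => ?_
    rw [pow_sub₀ _ (hq.ne k).1 hγ.le, inv_pow, mul_assoc]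
  -- Extension by zero to all naturals, so that the two end terms can be split off a sum over a
  -- range.
  let D : ℕ → ℂ := fun β => if hβ : β < N + 1 then optimalCoeff ω a b N q A B ⟨β, hβ⟩ else 0
  have hD : ∀ β : Fin (N + 1), optimalCoeff ω a b N q A B β = D β := fun β => by
    simp only [D, dif_pos β.2]
  simp_rw [hD]
  rw [Fin.sum_univ_eq_sum_range (fun β => D β * u β) (N + 1), Finset.sum_range_succ,
    Finset.range_eq_Ico, Finset.sum_eq_sum_Ico_succ_bot hN, ← hleft, ← hright, hD, hD]
  simp only [zero_add, Fin.val_last, Fin.val_zero]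
  congr 2
  refine Finset.sum_congr rfl fun γ hγ => ?_
  obtain ⟨h1, h2⟩ := Finset.mem_Ico.mp hγ
  rw [← hmid γ h1 h2, hD]

theorem isOptimal_iff_eq_optimalCoeff (hq : IsRootList m q) (hm : 1 ≤ m) (hab : a < b) (hN : 1 ≤ N)
    (hω : ω ≠ 0) (hωh : ∃ n : ℤ, ω * step a b N = n) {A B : Fin (m - 1) → ℂ}
    (hAB : IsSolution m ω a b N q A B) (C : Fin (N + 1) → ℂ) :
    IsOptimal m ω a b N C ↔ C = optimalCoeff ω a b N q A B := by
  have hexp : expo ω b = expo ω a := by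
    have := exp_node hωh N
    rwa [node_self hN] at this
  have hc : (2 * Real.pi * Complex.I * ω : ℂ) ≠ 0 := by
    simp [Complex.I_ne_zero, Real.pi_ne_zero, hω]
  have hmom := (isSolution_iff (fun k => (hq.ne k).2.1) hexp A B).mp hAB
  have hj : ∀ j, 1 ≤ j → j < m → j ∈ Finset.Icc 1 (m - 1) := fun j h1 h2 =>
    Finset.mem_Icc.mpr ⟨h1, by omega⟩
  have hF := eulerSpline_isDerivChain (κ := 1) (a := a) (b := b) (N := N) (r := multipliers q)
    (α := amplitudes N q A B) hm hc 
    (fun h => by subst h; exact (inferInstance : IsEmpty (Fin 0 ⊕ Fin 0)))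
  refine isOptimal_iff_of_representation hm hN hab hF (fun β hβ => ?_) (fun φ hφ => ?_) C
  · exact eulerSpline_node_eq_zero hm hab hN hq.multipliers_ne_one hq.multipliers_root hβ
      (exp_node hωh β)
  · have hrep := eulerSpline_representation (κ := 1) (r := multipliers q)
      (α := amplitudes N q A B) hm hab hN hc hq.multipliers_ne_one hexp
      (fun j h1 h2 => by rw [hq.moment_zero, one_mul]; exact (hmom j (hj j h1 h2)).1)
      (fun j h1 h2 => by rw [hq.moment_right, one_mul]; exact (hmom j (hj j h1 h2)).2) hφ
    have hsum := sum_optimalCoeff_mul hq hab hN hω hexp A B (fun β => φ (node a b N β))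
    simp only [node_zero, node_self hN] at hsum
    rw [quadError, hsum, show 2 * m - 1 - m = m - 1 by omega, ← hrep, one_mul]

end system

end OptQuad

end

theorem theorem10 (m N : ℕ) (hm : 1 ≤ m) (hN : 1 ≤ N) (hNm : m ≤ N + 1)
    (a b ω : ℝ) (hab : a < b) (hω : ω ≠ 0)
    (hωh : ∃ n : ℤ, ω * OptQuad.step a b N = n) :
    (∃ q : Fin (m - 1) → ℂ, OptQuad.IsRootList m q) ∧
    ∀ q : Fin (m - 1) → ℂ, OptQuad.IsRootList m q →
      ∃ A B : Fin (m - 1) → ℂ,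
        OptQuad.IsSolution m ω a b N q A B ∧
        (∀ A' B' : Fin (m - 1) → ℂ,
          OptQuad.IsSolution m ω a b N q A' B' → A' = A ∧ B' = B) ∧
        ∀ C : Fin (N + 1) → ℂ, OptQuad.IsOptimal m ω a b N C ↔
          (C 0 = (OptQuad.step a b N : ℂ) *
              (-(OptQuad.expo ω a / OptQuad.freq ω (OptQuad.step a b N))
                + ∑ k, (A k * (q k / (q k - 1)) + B k * (q k ^ N / (1 - q k)))) ∧
            (∀ β : Fin (N + 1), 1 ≤ (β : ℕ) → (β : ℕ) ≤ N - 1 →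
              C β = (OptQuad.step a b N : ℂ) *
                ∑ k, (A k * q k ^ (β : ℕ) + B k * q k ^ (N - (β : ℕ)))) ∧
            C (Fin.last N) = (OptQuad.step a b N : ℂ) *
              (OptQuad.expo ω b / OptQuad.freq ω (OptQuad.step a b N)
                + ∑ k, (A k * (q k ^ N / (1 - q k)) + B k * (q k / (q k - 1))))) := by
  refine ⟨OptQuad.exists_isRootList m, fun q hq => ?_⟩
  obtain ⟨A, B, hAB, huniq⟩ := hq.existsUnique_isSolution hab hN hNm hω hωh
  refine ⟨A, B, hAB, huniq, fun C => ?_⟩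
  rw [OptQuad.isOptimal_iff_eq_optimalCoeff hq hm hab hN hω hωh hAB C]
  constructor
  · rintro rfl
    refine ⟨by simp [OptQuad.optimalCoeff], fun β h1 h2 => ?_, ?_⟩
    · rw [OptQuad.optimalCoeff, if_neg (by omega), if_neg (by omega)]
    · rw [OptQuad.optimalCoeff, Fin.val_last, if_neg (by omega), if_pos rfl]
  · rintro ⟨h0, hmid, hlast⟩
    funext β
    rw [OptQuad.optimalCoeff]
    split_ifs with e0 eN
    · rw [show β = 0 from Fin.ext e0, h0]
    · rw [show β = Fin.last N from Fin.ext eN, hlast]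
    · exact hmid β (by omega) (by have := β.2; omega)
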